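/- Let $M$ be a complex manifold of dimension $n$ and $X\subset M$ a closed complex submanifold of (pure) dimension $r$, $0\le r<n$. Let $\mathrm{End}(M,X)$ be the set of germs along $X$ of holomorphic self-maps of $M$ that map $X$ into itself. Let $\tilde M_X=(M\setminus X)\cup E_X$ be the blow-up of $M$ along $X$, where $E_X=\bigcup_{p\in X}E_p$ and $E_p=\mathbb P(T_pM/T_pX)$, with its standard complex manifold structure and its projection $\sigma:\tilde M_X\to M$, so that $\sigma|_{M\setminus X}=\mathrm{id}$, $\sigma|_{E_p}\equiv p$ and $E_X=\sigma^{-1}(X)$. A chart $(V,\varphi)$, $\varphi=(z_1,\dots,z_n)$, of $M$ is *adapted to $X$* if there is a splitting $\{1,\dots,n\}=\mathcal P'\cup\mathcal P''$ with $\operatorname{card}\mathcal P'=r$ and $V\cap X=\{z_j=0\ \text{for all } j\in\mathcal P''\}$; write $z'=(z_j)_{j\in\mathcal P'}$ and $z''=(z_j)_{j\in\mathcal P''}$. For $p\in V\cap X$ the chart gives an isomorphism $\iota_{p,\varphi}:E_p\to\mathbb P(\mathbb C^{\mathcal P''})\cong\mathbb P^{n-r-1}(\mathbb C)$, $[v]\mapsto[(d(z_j)_p(v))_{j\in\mathcal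 P''}]$. Let $F\in\mathrm{End}(M,X)$. Given $p\in X$ and charts $(V,\varphi)$, $(\tilde V,\tilde\varphi)$ adapted to $X$ with $p\in V$, $F(p)\in\tilde V$, expand near $\varphi(p)$ $$\tilde\varphi\circ F\circ\varphi^{-1}(z)=\sum_{l\ge0}P_{l,z'}(z''),$$ where $P_{l,z'}$ is an $n$-tuple of homogeneous polynomials of degree $l$ in $z''$ with coefficients holomorphic in $z'$. Let $\nu_X(F,p)$ be the minimum, over all such pairs of charts, of $\min\{l\mid (P_{l,\varphi(p)'})''\not\equiv0\}$ (with $\min\emptyset=\infty$), and let $\nu_X(F)=\min\{\nu_X(F,p)\mid p\in X\}$. The germ $F$ is *non-degenerate along $X$* if for every $p\in X$: (i) $F^{-1}(p)\subseteq X$ (as germs along $X$); (ii) $\nu_X(F,p)=\nu_X(F)$; (iii) for some pair of adapted charts as above, and with $l_0=\nu_X(F)<\infty$, $\bigl(P_{l_0,\varphi(p)'}(v)\bigr)''=0$ if and only if $v=0\in\mathbb C^{n-r}$. **Proposition 2.1.** Let $F\in\mathrm{End}(M,X)$ be non-degenerate along $X$. Then there exists a unique $\tilde F\in\mathrm{End}(\tilde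 M_X,E_X)$ such that $F\circ\sigma=\sigma\circ\tilde F$. Furthermore, if $p\in X$ and $(V,\varphi)$, $(\tilde V,\tilde\varphi)$ are any charts adapted to $X$ with $p\in V$ and $F(p)\in\tilde V$, then for all $[v]\in E_p$ $$\tilde F([v])=(\iota_{F(p),\tilde\varphi})^{-1}\Bigl(\bigl[\,P_{l_0,\varphi(p)'}\bigl(\iota_{p,\varphi}([v])\bigr)''\,\bigr]\Bigr),\qquad l_0=\nu_X(F),\tag{2.1}$$ and in particular $P_{l_0,\varphi(p)'}(u)''\neq0$ for every $u$ representing $\iota_{p,\varphi}([v])$. -/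

import Mathlib

open scoped Manifold ContDiff Topology

namespace HolBlowUp

theorem analyticAt_average {E : Type*} [NormedAddCommGroup E] [NormedSpace ℂ E]
    {h : E → ℂ} {w₀ : E} (hh : AnalyticAt ℂ h w₀) (L : ℝ → E →L[ℂ] E)
    (hLc : Continuous L) (hL : ∀ t ∈ Set.uIoc (0 : ℝ) 1, ‖L t‖ ≤ 1) (hw : ∀ t, L t w₀ = w₀) :
    AnalyticAt ℂ (fun w => ∫ t in (0 : ℝ)..1, h (L t w)) w₀ := by
  obtain ⟨p, r, hp⟩ := hh
  have hc : ∀ k, Continuous (fun t => (p k).compContinuousLinearMap (fun _ => L t)) := by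
    intro k
    have h1 := (ContinuousMultilinearMap.compContinuousLinearMapContinuousMultilinear ℂ
      (fun _ : Fin k => E) (fun _ : Fin k => E) ℂ).cont
    have h2 : Continuous (fun t : ℝ => (fun _ : Fin k => L t)) := by fun_prop
    exact (h1.comp h2).clm_apply continuous_const
  have hn : ∀ k, ∀ t ∈ Set.uIoc (0 : ℝ) 1,
      ‖(p k).compContinuousLinearMap (fun _ => L t)‖ ≤ ‖p k‖ := by
    intro k t ht
    refine (ContinuousMultilinearMap.norm_compContinuousLinearMap_le _ _).trans ?_
    have : ∏ i : Fin k, ‖L t‖ ≤ 1 := by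
      simpa using pow_le_one₀ (norm_nonneg _) (hL t ht)
    simpa using mul_le_mul_of_nonneg_left this (norm_nonneg (p k))
  let q : FormalMultilinearSeries ℂ E ℂ := fun k =>
    ∫ t in (0 : ℝ)..1, (p k).compContinuousLinearMap (fun _ => L t)
  have hq : ∀ k, ‖q k‖ ≤ ‖p k‖ := by
    intro k
    simpa using intervalIntegral.norm_integral_le_of_norm_le_const (hn k)
  have hqa : ∀ k (y : E), q k (fun _ => y) = ∫ t in (0 : ℝ)..1, p k (fun _ => L t y) := by
    intro k y
    let A : ContinuousMultilinearMap ℂ (fun _ : Fin k => E) ℂ →L[ℂ] ℂ :=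
      ContinuousMultilinearMap.apply ℂ (fun _ : Fin k => E) ℂ (fun _ => y)
    have := A.intervalIntegral_comp_comm ((hc k).intervalIntegrable (μ := MeasureTheory.volume) 0 1)
    exact this.symm
  refine ⟨q, r, ?_, hp.r_pos, ?_⟩
  · exact hp.r_le.trans (FormalMultilinearSeries.radius_le_of_le (fun {k} => hq k))
  · intro y hy
    have hyr : (‖y‖₊ : ENNReal) < p.radius := by
      have : y ∈ Metric.eball (0 : E) r := hy
      have h3 : (‖y‖₊ : ENNReal) < r := by simpa [enorm] using this
      exact h3.trans_le hp.r_le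
    have hs : Summable (fun k => ‖p k‖ * (‖y‖₊ : ℝ) ^ k) :=
      p.summable_norm_mul_pow hyr
    have hmem : ∀ t ∈ Set.uIoc (0 : ℝ) 1, L t y ∈ Metric.eball (0 : E) r := by
      intro t ht
      have h4 : ‖L t y‖₊ ≤ ‖y‖₊ := by
        have := (L t).le_opNorm y
        have h5 := mul_le_mul_of_nonneg_right (hL t ht) (norm_nonneg y)
        have h6 : ‖L t y‖ ≤ ‖y‖ := by linarith
        exact h6
      have h7 : (‖y‖₊ : ENNReal) < r := by simpa [enorm] using hy
      have : (‖L t y‖₊ : ENNReal) < r := lt_of_le_of_lt (by exact_mod_cast h4) h7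
      simpa [enorm] using this
    have key := intervalIntegral.hasSum_integral_of_dominated_convergence
      (μ := MeasureTheory.volume) (a := 0) (b := 1)
      (F := fun k t => p k (fun _ => L t y)) (f := fun t => h (L t (w₀ + y)))
      (fun k _ => ‖p k‖ * (‖y‖₊ : ℝ) ^ k) ?_ ?_ ?_ ?_ ?_
    · simpa [hqa] using key
    · intro k
      have : Continuous (fun t => p k (fun _ => L t y)) :=
        (p k).cont.comp (by fun_prop)
      exact this.aestronglyMeasurable
    · intro k
      refine Filter.Eventually.of_forall fun t ht => ?_
      have h8 := ((p k).compContinuousLinearMap (fun _ => L t)).le_opNorm (fun _ => y)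
      have h9 := hn k t ht
      simp only [ContinuousMultilinearMap.compContinuousLinearMap_apply, Finset.prod_const,
        Finset.card_univ, Fintype.card_fin] at h8
      exact h8.trans (mul_le_mul_of_nonneg_right h9 (by positivity))
    · exact Filter.Eventually.of_forall fun t _ => hs
    · exact continuous_const.intervalIntegrable _ _
    · refine Filter.Eventually.of_forall fun t ht => ?_
      have := hp.hasSum (hmem t ht)
      simpa [map_add, hw t] using this

open Classical in
theorem analyticAt_divCoord {n : ℕ} {g : (Fin n → ℂ) → ℂ} {w₀ : Fin n → ℂ} (j : Fin n)
    (hg : AnalyticAt ℂ g w₀) (hj : w₀ j = 0) (h0 : ∀ᶠ w in 𝓝 w₀, w j = 0 → g w = 0) :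
    AnalyticAt ℂ (fun w => if w j = 0 then fderiv ℂ g w (Pi.single j 1) else g w / w j) w₀ := by
  let P : (Fin n → ℂ) →L[ℂ] (Fin n → ℂ) :=
    (ContinuousLinearMap.proj (R := ℂ) (φ := fun _ : Fin n => ℂ) j).smulRight (Pi.single j 1)
  have hP : ∀ w, P w = w j • Pi.single j 1 := fun w => rfl
  let L : ℝ → (Fin n → ℂ) →L[ℂ] (Fin n → ℂ) := fun t =>
    ContinuousLinearMap.id ℂ _ + ((t : ℂ) - 1) • P
  have hLa : ∀ t w i, L t w i = if i = j then (t : ℂ) * w i else w i := by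
    intro t w i
    by_cases hi : i = j
    · subst hi; simp [L, hP]; ring
    · simp [L, hP, hi]
  have hLw : ∀ t, L t w₀ = w₀ := by
    intro t; ext i; rw [hLa]; split_ifs with hi
    · subst hi; simp [hj]
    · rfl
  have hLn' : ∀ t ∈ Set.Icc (0 : ℝ) 1, ∀ w, ‖L t w‖ ≤ ‖w‖ := by
    intro t ht w
    refine (pi_norm_le_iff_of_nonneg (norm_nonneg _)).2 fun i => ?_
    rw [hLa]; split_ifs with hi
    · rw [norm_mul]
      have : ‖(t : ℂ)‖ ≤ 1 := by simpa [abs_of_nonneg ht.1] using ht.2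
      calc _ ≤ 1 * ‖w i‖ := mul_le_mul_of_nonneg_right this (norm_nonneg _)
        _ ≤ ‖w‖ := by simpa using norm_le_pi_norm w i
    · exact norm_le_pi_norm w i
  have hLn : ∀ t ∈ Set.uIoc (0 : ℝ) 1, ‖L t‖ ≤ 1 := by
    intro t ht
    rw [Set.uIoc_of_le zero_le_one] at ht
    exact ContinuousLinearMap.opNorm_le_bound _ zero_le_one
      (fun w => by simpa using hLn' t ⟨ht.1.le, ht.2⟩ w)
  have hLc : Continuous L := by
    have : Continuous (fun t : ℝ => ((t : ℂ) - 1)) := by fun_prop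
    exact continuous_const.add (this.smul continuous_const)
  have hh : AnalyticAt ℂ (fun w => fderiv ℂ g w (Pi.single j 1)) w₀ :=
    ((ContinuousLinearMap.apply ℂ ℂ (Pi.single j (1 : ℂ) : Fin n → ℂ)).analyticAt _).comp hg.fderiv
  refine (analyticAt_average hh L hLc hLn hLw).congr ?_
  -- a ball on which everything is analytic
  obtain ⟨ε, hε, hball⟩ := Metric.eventually_nhds_iff_ball.1 (hg.eventually_analyticAt.and h0)
  filter_upwards [Metric.ball_mem_nhds w₀ hε] with w hw
  have hin : ∀ t ∈ Set.Icc (0 : ℝ) 1, L t w ∈ Metric.ball w₀ ε := by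
    intro t ht
    rw [mem_ball_iff_norm] at hw ⊢
    have : L t w - w₀ = L t (w - w₀) := by rw [map_sub, hLw]
    rw [this]; exact (hLn' t ht _).trans_lt hw
  by_cases hwj : w j = 0
  · have : ∀ t, L t w = w := by
      intro t; ext i; rw [hLa]; split_ifs with hi
      · subst hi; simp [hwj]
      · rfl
    simp [hwj, this]
  · simp only [hwj, if_false]
    have hderiv : ∀ t ∈ Set.uIcc (0 : ℝ) 1, HasDerivAt (fun t : ℝ => g (L t w))
        (fderiv ℂ g (L t w) (w j • Pi.single j 1)) t := by
      intro t ht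
      rw [Set.uIcc_of_le zero_le_one] at ht
      have h1 := (hball _ (hin t ht)).1.differentiableAt.hasFDerivAt.restrictScalars ℝ
      have h2 : HasDerivAt (fun t : ℝ => L t w) (w j • Pi.single j (1 : ℂ)) t := by
        have h3 : HasDerivAt (fun t : ℝ => w + ((t : ℂ) - 1) • (w j • Pi.single j (1 : ℂ)
            : Fin n → ℂ)) ((1 : ℂ) • (w j • Pi.single j (1 : ℂ))) t := by
          have h4 : HasDerivAt (fun t : ℝ => (t : ℂ) - 1) 1 t :=
            (Complex.ofRealCLM.hasDerivAt (x := t)).sub_const 1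
          exact (h4.smul_const _).const_add w
        simpa [L, hP] using h3
      exact h1.comp_hasDerivAt t h2
    have hcont : ContinuousOn (fun t : ℝ => fderiv ℂ g (L t w) (w j • Pi.single j 1))
        (Set.uIcc 0 1) := by
      intro t ht
      rw [Set.uIcc_of_le zero_le_one] at ht
      have h1 : ContinuousAt (fderiv ℂ g) (L t w) := (hball _ (hin t ht)).1.fderiv.continuousAt
      have h2 : ContinuousAt (fun t => L t w) t := by fun_prop
      have h3 : ContinuousAt (fun t : ℝ => fderiv ℂ g (L t w)) t :=
        ContinuousAt.comp (f := fun t => L t w) h1 h2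
      exact (h3.clm_apply continuousAt_const).continuousWithinAt
    have hint := intervalIntegral.integral_eq_sub_of_hasDerivAt hderiv hcont.intervalIntegrable
    have e1 : L 1 w = w := by ext i; rw [hLa]; split_ifs <;> simp
    have e0 : g (L 0 w) = 0 := by
      refine (hball _ (hin 0 ⟨le_rfl, zero_le_one⟩)).2 ?_
      rw [hLa]; simp
    rw [e1, e0, sub_zero] at hint
    simp only [map_smul, smul_eq_mul] at hint
    rw [intervalIntegral.integral_const_mul] at hint
    rw [← hint]; field_simp

/-- A chart `φ` of the `n`-dimensional complex manifold `M` is adapted to `X`, of dimension `r`, with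
normal indices `S` (the block `𝒫''` of a splitting `{1, …, n} = 𝒫' ∪ 𝒫''` of weight `r`), if on
the domain of the chart `X` is `{z_j = 0 for all j ∈ S}`. -/
structure IsAdapted {n : ℕ} {M : Type*} [TopologicalSpace M] [ChartedSpace (Fin n → ℂ) M]
    (r : ℕ) (X : Set M) (φ : OpenPartialHomeomorph M (Fin n → ℂ)) (S : Finset (Fin n)) : Prop where
  mem_maximalAtlas : φ ∈ IsManifold.maximalAtlas 𝓘(ℂ, Fin n → ℂ) ω M
  card_eq : r + S.card = n
  mem_iff : ∀ q ∈ φ.source, q ∈ X ↔ ∀ j ∈ S, φ q j = 0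

/-- A closed complex submanifold of pure dimension `r` of the `n`-dimensional manifold `M`. -/
structure ClosedSubmanifold (n : ℕ) (M : Type*) [TopologicalSpace M] [ChartedSpace (Fin n → ℂ) M]
    (r : ℕ) where
  carrier : Set M
  isClosed : IsClosed carrier
  exists_adapted : ∀ p ∈ carrier, ∃ (φ : OpenPartialHomeomorph M (Fin n → ℂ)) (S : Finset (Fin n)),
    IsAdapted r carrier φ S ∧ p ∈ φ.source

/-- The tangent space `T_p X ⊆ T_p M`: the vectors killed by the differential at `p` of every
holomorphic function near `p` that vanishes on `X` near `p`. -/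
def tangentSub (n : ℕ) {M : Type*} [TopologicalSpace M] [ChartedSpace (Fin n → ℂ) M]
    (X : Set M) (p : M) : Submodule ℂ (TangentSpace 𝓘(ℂ, Fin n → ℂ) p) where
  carrier := {v | ∀ f : M → ℂ, ContMDiffAt 𝓘(ℂ, Fin n → ℂ) 𝓘(ℂ) ω f p →
    (∀ᶠ q in 𝓝 p, q ∈ X → f q = 0) → mfderiv 𝓘(ℂ, Fin n → ℂ) 𝓘(ℂ) f p v = 0}
  add_mem' := by
    intro v w hv hw f hf h0
    rw [map_add, hv f hf h0, hw f hf h0, add_zero]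
  zero_mem' := by
    intro f _ _
    exact map_zero _
  smul_mem' := by
    intro c v hv f hf h0
    rw [map_smul, hv f hf h0, smul_zero]

/-- The fibre `T_p M / T_p X` of the normal bundle. -/
abbrev NormalSpace (n : ℕ) {M : Type*} [TopologicalSpace M] [ChartedSpace (Fin n → ℂ) M]
    (X : Set M) (p : M) : Type :=
  TangentSpace 𝓘(ℂ, Fin n → ℂ) p ⧸ tangentSub n X p

/-- The fibre `E_p = ℙ(T_p M / T_p X)` of the projectivized normal bundle. -/
abbrev ExcFiber (n : ℕ) {M : Type*} [TopologicalSpace M] [ChartedSpace (Fin n → ℂ) M]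
    (X : Set M) (p : M) : Type :=
  Projectivization ℂ (NormalSpace n X p)

/-- The underlying set `(M ∖ X) ∪ ⋃_{p ∈ X} E_p` of the blow-up of `M` along `X`. -/
inductive BlowUp {n : ℕ} {M : Type*} [TopologicalSpace M] [ChartedSpace (Fin n → ℂ) M] {r : ℕ}
    (X : ClosedSubmanifold n M r) where
  | pt (q : M) (hq : q ∉ X.carrier) : BlowUp X
  | exc (p : M) (hp : p ∈ X.carrier) (e : ExcFiber n X.carrier p) : BlowUp X

section

variable {n r : ℕ} {M : Type*} [TopologicalSpace M] [ChartedSpace (Fin n → ℂ) M]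

namespace BlowUp

variable {X : ClosedSubmanifold n M r}

/-- The projection `σ` of the blow-up onto `M`. -/
def proj : BlowUp X → M
  | pt q _ => q
  | exc p _ _ => p

/-- The exceptional divisor `E_X = σ⁻¹(X)`. -/
def excDivisor (X : ClosedSubmanifold n M r) : Set (BlowUp X) := proj ⁻¹' X.carrier

/-- In the chart `φ = (z_1, …, z_n)`: the vector `(z_h(q))_h` at a point `q ∉ X`, and the vector
`(d(z_h)_p(v))_h`, for a representative `v ∈ T_p M`, at a point `[v] ∈ E_p`. In an adapted chart the
normal components, on the exceptional divisor, are well defined up to a common nonzero factor. -/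
noncomputable def normalVec (φ : OpenPartialHomeomorph M (Fin n → ℂ)) : BlowUp X → Fin n → ℂ
  | pt q _ => φ q
  | exc p _ e => mfderiv 𝓘(ℂ, Fin n → ℂ) 𝓘(ℂ, Fin n → ℂ) φ p (Quotient.out e.rep)

/-- The domain `V_j` of `χ_j`. -/
def chiSource (X : ClosedSubmanifold n M r) (φ : OpenPartialHomeomorph M (Fin n → ℂ)) (j : Fin n) :
    Set (BlowUp X) :=
  {b | proj b ∈ φ.source ∧ normalVec φ b j ≠ 0}

open Classical in
/-- The coordinate map `χ_j` of the blow-up, given by an adapted chart `φ` with normal indices `S`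
and by `j ∈ S`. -/
noncomputable def chi (φ : OpenPartialHomeomorph M (Fin n → ℂ)) (S : Finset (Fin n)) (j : Fin n)
    (b : BlowUp X) : Fin n → ℂ := fun h =>
  if h ∈ S ∧ h ≠ j then normalVec φ b h / normalVec φ b j else φ (proj b) h

open Classical in
/-- The expression of `σ` in the coordinates `χ_j` and `φ`. -/
noncomputable def beta (S : Finset (Fin n)) (j : Fin n) (w : Fin n → ℂ) : Fin n → ℂ := fun h =>
  if h ∈ S ∧ h ≠ j then w j * w h else w h

/-- The image of `χ_j`. -/
def chiTarget (φ : OpenPartialHomeomorph M (Fin n → ℂ)) (S : Finset (Fin n)) (j : Fin n) :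
    Set (Fin n → ℂ) := beta S j ⁻¹' φ.target


end BlowUp

theorem mdifferentiable_adaptedChart {φ : OpenPartialHomeomorph M (Fin n → ℂ)}
    (hφ : φ ∈ IsManifold.maximalAtlas 𝓘(ℂ, Fin n → ℂ) ω M) :
    φ.MDifferentiable 𝓘(ℂ, Fin n → ℂ) 𝓘(ℂ, Fin n → ℂ) := by
  have h1 := IsManifold.maximalAtlas_subset_of_le (I := 𝓘(ℂ, Fin n → ℂ)) (M := M)
    (show (1 : WithTop ℕ∞) ≤ ω from le_top) hφ
  exact ⟨fun x hx => (mdifferentiableAt_of_mem_maximalAtlas h1 hx).mdifferentiableWithinAt,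
    fun x hx => (mdifferentiableAt_symm_of_mem_maximalAtlas h1 hx).mdifferentiableWithinAt⟩

theorem analyticAt_transition {φ ψ : OpenPartialHomeomorph M (Fin n → ℂ)}
    (hφ : φ ∈ IsManifold.maximalAtlas 𝓘(ℂ, Fin n → ℂ) ω M)
    (hψ : ψ ∈ IsManifold.maximalAtlas 𝓘(ℂ, Fin n → ℂ) ω M) {z : Fin n → ℂ}
    (hz : z ∈ φ.target) (hz' : φ.symm z ∈ ψ.source) :
    AnalyticAt ℂ (fun x => ψ (φ.symm x)) z := by
  have h1 := contMDiffAt_symm_of_mem_maximalAtlas hφ hz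
  have h2 := contMDiffAt_of_mem_maximalAtlas hψ hz'
  exact (h2.comp z h1).contDiffAt.analyticAt

theorem mfderiv_transition {φ ψ : OpenPartialHomeomorph M (Fin n → ℂ)}
    (hφ : φ ∈ IsManifold.maximalAtlas 𝓘(ℂ, Fin n → ℂ) ω M)
    (hψ : ψ ∈ IsManifold.maximalAtlas 𝓘(ℂ, Fin n → ℂ) ω M) {p : M}
    (hp : p ∈ φ.source) (hp' : p ∈ ψ.source) (v : TangentSpace 𝓘(ℂ, Fin n → ℂ) p) :
    mfderiv 𝓘(ℂ, Fin n → ℂ) 𝓘(ℂ, Fin n → ℂ) ψ p v =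
      fderiv ℂ (fun x => ψ (φ.symm x)) (φ p)
        (mfderiv 𝓘(ℂ, Fin n → ℂ) 𝓘(ℂ, Fin n → ℂ) φ p v) := by
  have h1 : HasFDerivAt (fun x => ψ (φ.symm x))
      (fderiv ℂ (fun x => ψ (φ.symm x)) (φ p)) (φ p) :=
    (analyticAt_transition hφ hψ (φ.map_source hp)
      (by rwa [φ.left_inv hp])).differentiableAt.hasFDerivAt
  have h2 := ((mdifferentiable_adaptedChart hφ).mdifferentiableAt hp).hasMFDerivAt
  have h3 := h1.hasMFDerivAt.comp p h2
  have hev : ψ =ᶠ[𝓝 p] (fun x => ψ (φ.symm x)) ∘ φ := by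
    filter_upwards [φ.open_source.mem_nhds hp] with q hq
    simp [φ.left_inv hq]
  have h4 := h3.congr_of_eventuallyEq hev
  rw [h4.mfderiv]
  rfl

/-- The normal components `(d(z_j)_p(v))_{j ∈ S}` of a tangent vector. -/
noncomputable def normalLin (φ : OpenPartialHomeomorph M (Fin n → ℂ)) (S : Finset (Fin n)) (p : M) :
    TangentSpace 𝓘(ℂ, Fin n → ℂ) p →ₗ[ℂ] (S → ℂ) where
  toFun v j := mfderiv 𝓘(ℂ, Fin n → ℂ) 𝓘(ℂ, Fin n → ℂ) φ p v j
  map_add' v w := by ext j; rw [map_add]; rfl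
  map_smul' c v := by ext j; rw [map_smul]; rfl

theorem ker_normalLin {X : Set M} {φ : OpenPartialHomeomorph M (Fin n → ℂ)}
    {S : Finset (Fin n)} (hφ : IsAdapted r X φ S) {p : M} (hp : p ∈ φ.source) (hpX : p ∈ X) :
    LinearMap.ker (normalLin φ S p) = tangentSub n X p := by
  have hd := ((mdifferentiable_adaptedChart hφ.mem_maximalAtlas).mdifferentiableAt hp).hasMFDerivAt
  apply le_antisymm
  · intro v hv f hf h0
    have hv' : ∀ j ∈ S, mfderiv 𝓘(ℂ, Fin n → ℂ) 𝓘(ℂ, Fin n → ℂ) φ p v j = 0 := by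
      intro j hj
      exact congrFun (LinearMap.mem_ker.1 hv) ⟨j, hj⟩
    have h1 := contMDiffAt_symm_of_mem_maximalAtlas hφ.mem_maximalAtlas (φ.map_source hp)
    have h2 : ContMDiffAt 𝓘(ℂ, Fin n → ℂ) 𝓘(ℂ) ω (fun x => f (φ.symm x)) (φ p) := by
      refine ContMDiffAt.comp (φ p) ?_ h1
      rwa [φ.left_inv hp]
    have h3 : HasFDerivAt (fun x => f (φ.symm x))
        (fderiv ℂ (fun x => f (φ.symm x)) (φ p)) (φ p) :=
      h2.contDiffAt.analyticAt.differentiableAt.hasFDerivAt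
    have hev : f =ᶠ[𝓝 p] (fun x => f (φ.symm x)) ∘ φ := by
      filter_upwards [φ.open_source.mem_nhds hp] with q hq
      simp [φ.left_inv hq]
    have h5 := (h3.hasMFDerivAt.comp p hd).congr_of_eventuallyEq hev
    rw [h5.mfderiv]
    change fderiv ℂ (fun x => f (φ.symm x)) (φ p)
      (mfderiv 𝓘(ℂ, Fin n → ℂ) 𝓘(ℂ, Fin n → ℂ) φ p v) = 0
    set u : Fin n → ℂ := mfderiv 𝓘(ℂ, Fin n → ℂ) 𝓘(ℂ, Fin n → ℂ) φ p v with hu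
    have h6 : HasDerivAt (fun t : ℂ => φ p + t • u) u 0 := by
      simpa using ((hasDerivAt_id (0 : ℂ)).smul_const u).const_add (φ p)
    have h7 : HasDerivAt (fun t : ℂ => f (φ.symm (φ p + t • u)))
        (fderiv ℂ (fun x => f (φ.symm x)) (φ p) u) 0 := by
      have h3' : HasFDerivAt (fun x => f (φ.symm x))
        (fderiv ℂ (fun x => f (φ.symm x)) (φ p)) (φ p + (0 : ℂ) • u) := by simpa using h3
      exact h3'.comp_hasDerivAt (0 : ℂ) h6
    have h8 : ∀ᶠ t : ℂ in 𝓝 0, f (φ.symm (φ p + t • u)) = 0 := by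
      have hc : Filter.Tendsto (fun t : ℂ => φ p + t • u) (𝓝 0) (𝓝 (φ p)) := by
        have := h6.continuousAt.tendsto
        simpa using this
      have hs : Filter.Tendsto φ.symm (𝓝 (φ p)) (𝓝 p) := by
        have := (φ.continuousAt_symm (φ.map_source hp)).tendsto
        rwa [φ.left_inv hp] at this
      filter_upwards [(hs.comp hc).eventually h0,
        hc.eventually (φ.open_target.mem_nhds (φ.map_source hp))] with t ht1 ht2
      apply ht1
      refine (hφ.mem_iff _ (φ.map_target ht2)).2 fun j hj => ?_
      rw [φ.right_inv ht2, Pi.add_apply, Pi.smul_apply, (hφ.mem_iff p hp).1 hpX j hj, hv' j hj,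
        smul_zero, add_zero]
    exact h7.unique ((hasDerivAt_const (0 : ℂ) (0 : ℂ)).congr_of_eventuallyEq h8)
  · intro v hv
    refine LinearMap.mem_ker.2 (funext fun j => ?_)
    have hf : ContMDiffAt 𝓘(ℂ, Fin n → ℂ) 𝓘(ℂ) ω (fun q => φ q j) p := by
      have h1 := contMDiffAt_of_mem_maximalAtlas hφ.mem_maximalAtlas hp
      exact (ContinuousLinearMap.proj (R := ℂ) (φ := fun _ : Fin n => ℂ)
        (j : Fin n)).contMDiff.contMDiffAt.comp p h1
    have h0 : ∀ᶠ q in 𝓝 p, q ∈ X → φ q j = 0 := by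
      filter_upwards [φ.open_source.mem_nhds hp] with q hq hqX
      exact (hφ.mem_iff q hq).1 hqX j j.2
    have h2 := hv _ hf h0
    have h3 := ((ContinuousLinearMap.proj (R := ℂ) (φ := fun _ : Fin n => ℂ)
        (j : Fin n)).hasFDerivAt (x := φ p)).hasMFDerivAt.comp p hd
    have h4 : HasMFDerivAt 𝓘(ℂ, Fin n → ℂ) 𝓘(ℂ) (fun q => φ q j) p _ := h3
    rw [h4.mfderiv] at h2
    exact h2

theorem normalLin_surjective {φ : OpenPartialHomeomorph M (Fin n → ℂ)}
    (hφ : φ ∈ IsManifold.maximalAtlas 𝓘(ℂ, Fin n → ℂ) ω M) (S : Finset (Fin n)) {p : M}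
    (hp : p ∈ φ.source) : Function.Surjective (normalLin φ S p) := by
  classical
  intro u
  obtain ⟨v, hv⟩ := (mdifferentiable_adaptedChart hφ).mfderiv_surjective hp
    (fun h => if h' : h ∈ S then u ⟨h, h'⟩ else 0 : Fin n → ℂ)
  refine ⟨v, funext fun j => ?_⟩
  have := congrFun hv (j : Fin n)
  simpa [normalLin] using this

/-- The isomorphism `T_p M / T_p X ≃ ℂ^S` given by an adapted chart,
`v ↦ (d(z_j)_p(v))_{j ∈ S}`. -/
noncomputable def normalEquiv {X : Set M} {φ : OpenPartialHomeomorph M (Fin n → ℂ)}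
    {S : Finset (Fin n)} (hφ : IsAdapted r X φ S) {p : M} (hp : p ∈ φ.source) (hpX : p ∈ X) :
    NormalSpace n X p ≃ₗ[ℂ] (S → ℂ) :=
  (Submodule.quotEquivOfEq _ _ (ker_normalLin hφ hp hpX).symm).trans
    ((normalLin φ S p).quotKerEquivOfSurjective (normalLin_surjective hφ.mem_maximalAtlas S hp))

theorem normalEquiv_mk {X : Set M} {φ : OpenPartialHomeomorph M (Fin n → ℂ)}
    {S : Finset (Fin n)} (hφ : IsAdapted r X φ S) {p : M} (hp : p ∈ φ.source) (hpX : p ∈ X)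
    (v : TangentSpace 𝓘(ℂ, Fin n → ℂ) p) (j : S) :
    normalEquiv hφ hp hpX (Submodule.Quotient.mk v) j =
      mfderiv 𝓘(ℂ, Fin n → ℂ) 𝓘(ℂ, Fin n → ℂ) φ p v j := rfl

/-- The isomorphism `ι_{p,φ} : E_p ≃ ℙ(ℂ^S)` given by an adapted chart,
`[v] ↦ [(d(z_j)_p(v))_{j ∈ S}]`. -/
noncomputable def iota {X : Set M} {φ : OpenPartialHomeomorph M (Fin n → ℂ)}
    {S : Finset (Fin n)} (hφ : IsAdapted r X φ S) {p : M} (hp : p ∈ φ.source) (hpX : p ∈ X) :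
    ExcFiber n X p ≃ Projectivization ℂ (S → ℂ) where
  toFun := Projectivization.map (normalEquiv hφ hp hpX).toLinearMap
    (normalEquiv hφ hp hpX).injective
  invFun := Projectivization.map (normalEquiv hφ hp hpX).symm.toLinearMap
    (normalEquiv hφ hp hpX).symm.injective
  left_inv e := by
    induction e using Projectivization.ind with
    | h v hv => simp [Projectivization.map_mk]
  right_inv e := by
    induction e using Projectivization.ind with
    | h v hv => simp [Projectivization.map_mk]

namespace BlowUp

variable {X : ClosedSubmanifold n M r} {φ ψ : OpenPartialHomeomorph M (Fin n → ℂ)}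
  {S T : Finset (Fin n)} {j : Fin n}

theorem normalVec_exc (hφ : IsAdapted r X.carrier φ S) {p : M} (hp : p ∈ φ.source)
    (hpX : p ∈ X.carrier) (u : NormalSpace n X.carrier p) (hu : u ≠ 0) :
    ∃ c : ℂ, c ≠ 0 ∧ ∀ i (hi : i ∈ S),
      normalVec φ (exc p hpX (Projectivization.mk ℂ u hu)) i =
        c * normalEquiv hφ hp hpX u ⟨i, hi⟩ := by
  obtain ⟨a, ha⟩ := Projectivization.exists_smul_eq_mk_rep ℂ u hu
  refine ⟨a, a.ne_zero, fun i hi => ?_⟩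
  have h1 := normalEquiv_mk hφ hp hpX (Quotient.out (Projectivization.mk ℂ u hu).rep) ⟨i, hi⟩
  have h2 : (Submodule.Quotient.mk (Quotient.out (Projectivization.mk ℂ u hu).rep) :
      NormalSpace n X.carrier p) = (Projectivization.mk ℂ u hu).rep := Quotient.out_eq _
  have h3 : normalEquiv hφ hp hpX (a • u) ⟨i, hi⟩ =
      (a : ℂ) * normalEquiv hφ hp hpX u ⟨i, hi⟩ := by
    rw [Units.smul_def, map_smul]; rfl
  have h4 : normalEquiv hφ hp hpX (Projectivization.mk ℂ u hu).rep ⟨i, hi⟩ =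
      (a : ℂ) * normalEquiv hφ hp hpX u ⟨i, hi⟩ := by
    rw [← ha]; exact h3
  exact h1.symm.trans ((congrArg (fun z => normalEquiv hφ hp hpX z ⟨i, hi⟩) h2).trans h4)

theorem chi_self (b : BlowUp X) : chi φ S j b j = φ (proj b) j := by
  simp [chi]

theorem chi_ratio (b : BlowUp X) {h : Fin n} (hh : h ∈ S) (hj : h ≠ j) :
    chi φ S j b h = normalVec φ b h / normalVec φ b j := by
  simp [chi, hh, hj]

theorem beta_chi (hφ : IsAdapted r X.carrier φ S) (hj : j ∈ S) {b : BlowUp X}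
    (hb : b ∈ chiSource X φ j) : beta S j (chi φ S j b) = φ (proj b) := by
  funext h
  unfold beta
  split_ifs with hh
  · rw [chi_self, chi_ratio b hh.1 hh.2]
    obtain ⟨hb1, hb2⟩ := hb
    cases b with
    | pt q hq =>
      simp only [normalVec, proj] at hb2 ⊢
      field_simp
    | exc p hp e =>
      simp only [proj] at hb1 ⊢
      rw [(hφ.mem_iff p hb1).1 hp j hj, (hφ.mem_iff p hb1).1 hp h hh.1, zero_mul]
  · simp [chi, hh]

theorem analyticAt_beta (S : Finset (Fin n)) (j : Fin n) (w : Fin n → ℂ) :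
    AnalyticAt ℂ (beta S j) w := by
  have hp : ∀ h : Fin n, AnalyticAt ℂ (fun w : Fin n → ℂ => w h) w := fun h =>
    (ContinuousLinearMap.proj (R := ℂ) (φ := fun _ : Fin n => ℂ) h).analyticAt w
  refine AnalyticAt.pi fun h => ?_
  unfold beta
  split_ifs with hh
  · exact (hp j).mul (hp h)
  · exact hp h

theorem injOn_chi (hφ : IsAdapted r X.carrier φ S) (hj : j ∈ S) :
    Set.InjOn (chi φ S j) (chiSource X φ j) := by
  intro b hb b' hb' h
  have h1 : φ (proj b) = φ (proj b') := by
    rw [← beta_chi hφ hj hb, ← beta_chi hφ hj hb', h]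
  have h2 : proj b = proj b' := φ.injOn hb.1 hb'.1 h1
  cases b with
  | pt q hq =>
    cases b' with
    | pt q' hq' =>
      simp only [proj] at h2; subst h2; rfl
    | exc p hp e => simp only [proj] at h2; subst h2; exact absurd hp hq
  | exc p hp e =>
    cases b' with
    | pt q' hq' => simp only [proj] at h2; subst h2; exact absurd hp hq'
    | exc p' hp' e' =>
      simp only [proj] at h2; subst h2
      have hs : p ∈ φ.source := hb.1
      congr 1
      induction e using Projectivization.ind with
      | h u hu =>
      induction e' using Projectivization.ind with
      | h u' hu' =>
      obtain ⟨c, hc, hcu⟩ := normalVec_exc hφ hs hp u hu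
      obtain ⟨c', hc', hcu'⟩ := normalVec_exc hφ hs hp u' hu'
      have hbj := hb.2
      have hbj' := hb'.2
      rw [hcu j hj] at hbj
      rw [hcu' j hj] at hbj'
      set y := normalEquiv hφ hs hp u with hy
      set y' := normalEquiv hφ hs hp u' with hy'
      have hyj : y ⟨j, hj⟩ ≠ 0 := right_ne_zero_of_mul hbj
      have hyj' : y' ⟨j, hj⟩ ≠ 0 := right_ne_zero_of_mul hbj'
      rw [Projectivization.mk_eq_mk_iff']
      refine ⟨y ⟨j, hj⟩ / y' ⟨j, hj⟩, ?_⟩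
      apply (normalEquiv hφ hs hp).injective
      rw [map_smul, ← hy, ← hy']
      funext i
      rw [Pi.smul_apply, smul_eq_mul]
      by_cases hij : (i : Fin n) = j
      · have : i = ⟨j, hj⟩ := Subtype.ext hij
        rw [this]; field_simp
      · have h3 := congrFun h (i : Fin n)
        rw [chi_ratio _ i.2 hij, chi_ratio _ i.2 hij, hcu i i.2, hcu' i i.2, hcu j hj,
          hcu' j hj] at h3
        rw [mul_div_mul_left _ _ hc, mul_div_mul_left _ _ hc'] at h3
        rw [div_eq_div_iff hyj hyj'] at h3
        field_simp
        linear_combination -h3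

open Classical in
theorem bijOn_chi (hφ : IsAdapted r X.carrier φ S) (hj : j ∈ S) :
    Set.BijOn (chi φ S j) (chiSource X φ j) (chiTarget φ S j) := by
  refine ⟨fun b hb => ?_, injOn_chi hφ hj, fun w hw => ?_⟩
  · change beta S j (chi φ S j b) ∈ φ.target
    rw [beta_chi hφ hj hb]
    exact φ.map_source hb.1
  · have hw : beta S j w ∈ φ.target := hw
    have hps := φ.map_target hw
    have hφp := φ.right_inv hw
    set p := φ.symm (beta S j w) with hp
    have hself : beta S j w j = w j := by simp [beta]
    by_cases hwj : w j = 0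
    · have hpX : p ∈ X.carrier := by
        refine (hφ.mem_iff p hps).2 fun h hh => ?_
        rw [hφp]
        by_cases hhj : h = j
        · rw [hhj, hself, hwj]
        · simp [beta, hh, hhj, hwj]
      let y : S → ℂ := fun i => if (i : Fin n) = j then 1 else w i
      have hu : (normalEquiv hφ hps hpX).symm y ≠ 0 := by
        intro h0
        have : y = 0 := by simpa using h0
        have := congrFun this ⟨j, hj⟩
        simp [y] at this
      obtain ⟨c, hc, hcu⟩ := normalVec_exc hφ hps hpX _ hu
      simp only [LinearEquiv.apply_symm_apply] at hcu
      refine ⟨exc p hpX (Projectivization.mk ℂ _ hu), ⟨hps, ?_⟩, ?_⟩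
      · rw [hcu j hj]; simpa [y] using hc
      · funext h
        by_cases hh : h ∈ S ∧ h ≠ j
        · rw [chi_ratio _ hh.1 hh.2, hcu h hh.1, hcu j hj, mul_div_mul_left _ _ hc]
          simp [y, hh.2]
        · simp only [chi, hh, if_false, proj, hφp]
          simp [beta, hh]
    · have hpX : p ∉ X.carrier := by
        intro h
        have := (hφ.mem_iff p hps).1 h j hj
        rw [hφp, hself] at this
        exact hwj this
      refine ⟨pt p hpX, ⟨hps, ?_⟩, ?_⟩
      · simp only [normalVec, hφp, hself]; exact hwj
      · funext h
        by_cases hh : h ∈ S ∧ h ≠ j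
        · rw [chi_ratio _ hh.1 hh.2]
          simp only [normalVec, hφp, hself]
          simp [beta, hh, hwj]
        · simp only [chi, hh, if_false, proj, hφp]
          simp [beta, hh]

theorem beta_add_single (S : Finset (Fin n)) (j : Fin n) (w : Fin n → ℂ) (t : ℂ) [DecidableEq (Fin n)] :
    beta S j (w + t • Pi.single j 1) =
      beta S j w + t • fun h => if h = j then 1 else if h ∈ S then w h else 0 := by
  funext h
  by_cases hj : h = j
  · subst hj; simp [beta]
  · by_cases hS : h ∈ S
    · simp [beta, hj, hS]; ring
    · simp [beta, hj, hS]

open Classical in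
/-- Homogeneous coordinates of a point of the blow-up with respect to the chart `ψ`, as a function
of its coordinates with respect to `χ_j`. -/
noncomputable def homCoord (φ ψ : OpenPartialHomeomorph M (Fin n → ℂ)) (S : Finset (Fin n))
    (j : Fin n) (w : Fin n → ℂ) (i : Fin n) : ℂ :=
  if w j = 0 then fderiv ℂ (fun x => ψ (φ.symm (beta S j x)) i) w (Pi.single j 1)
  else ψ (φ.symm (beta S j w)) i / w j

theorem analyticAt_pullback (hφ : φ ∈ IsManifold.maximalAtlas 𝓘(ℂ, Fin n → ℂ) ω M)
    (hψ : ψ ∈ IsManifold.maximalAtlas 𝓘(ℂ, Fin n → ℂ) ω M)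
    {w : Fin n → ℂ} (hw : w ∈ chiTarget φ S j)
    (hw' : φ.symm (beta S j w) ∈ ψ.source) :
    AnalyticAt ℂ (fun x => ψ (φ.symm (beta S j x))) w :=
  (analyticAt_transition hφ hψ hw hw').comp (analyticAt_beta S j w)

set_option linter.unusedSectionVars false in
theorem isOpen_chiTarget : IsOpen (chiTarget φ S j) := by
  refine φ.open_target.preimage ?_
  exact continuous_iff_continuousAt.2 fun w => (analyticAt_beta S j w).continuousAt

theorem analyticAt_homCoord (hφ : IsAdapted r X.carrier φ S) (hψ : IsAdapted r X.carrier ψ T)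
    {w : Fin n → ℂ} (hw : w ∈ chiTarget φ S j)
    (hw' : φ.symm (beta S j w) ∈ ψ.source) {i : Fin n} (hi : i ∈ T) :
    AnalyticAt ℂ (fun x => homCoord φ ψ S j x i) w := by
  have hp : ∀ h : Fin n, ∀ w, AnalyticAt ℂ (fun w : Fin n → ℂ => w h) w := fun h w =>
    (ContinuousLinearMap.proj (R := ℂ) (φ := fun _ : Fin n => ℂ) h).analyticAt w
  have hg : AnalyticAt ℂ (fun x => ψ (φ.symm (beta S j x)) i) w :=
    (hp i _).comp (analyticAt_pullback hφ.mem_maximalAtlas hψ.mem_maximalAtlas hw hw')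
  by_cases hwj : w j = 0
  · refine analyticAt_divCoord j hg hwj ?_
    have hb : ContinuousAt (beta S j) w := (analyticAt_beta S j w).continuousAt
    have hc : ContinuousAt (fun x => φ.symm (beta S j x)) w :=
      ContinuousAt.comp (f := beta S j) (φ.continuousAt_symm hw) hb
    filter_upwards [isOpen_chiTarget.mem_nhds hw, hc (ψ.open_source.mem_nhds hw')] with x hx hx' hxj
    refine (hψ.mem_iff _ hx').1 ?_ i hi
    refine (hφ.mem_iff _ (φ.map_target hx)).2 fun h hh => ?_
    rw [φ.right_inv hx]
    by_cases hhj : h = j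
    · simp [beta, hhj, hxj]
    · simp [beta, hh, hhj, hxj]
  · refine (hg.div (hp j w) hwj).congr ?_
    have : ∀ᶠ x : Fin n → ℂ in 𝓝 w, x j ≠ 0 := (hp j w).continuousAt.eventually_ne hwj
    filter_upwards [this] with x hx
    simp [homCoord, hx]

theorem normalVec_eq_homCoord (hφ : IsAdapted r X.carrier φ S) (hψ : IsAdapted r X.carrier ψ T)
    (hj : j ∈ S) {b : BlowUp X} (hb : b ∈ chiSource X φ j) (hb' : proj b ∈ ψ.source) :
    ∃ c : ℂ, c ≠ 0 ∧ ∀ i ∈ T, normalVec ψ b i = c * homCoord φ ψ S j (chi φ S j b) i := by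
  classical
  have hβ := beta_chi hφ hj hb
  have hself := chi_self (φ := φ) (S := S) (j := j) b
  have hw : chi φ S j b ∈ chiTarget φ S j := (bijOn_chi hφ hj).mapsTo hb
  have hinv : φ.symm (beta S j (chi φ S j b)) = proj b := by rw [hβ, φ.left_inv hb.1]
  cases b with
  | pt q hq =>
    refine ⟨φ q j, hb.2, fun i _ => ?_⟩
    have h0 : φ q j ≠ 0 := hb.2
    unfold homCoord
    rw [hinv, hself]
    simp only [proj, normalVec, h0, if_false]
    field_simp
  | exc p hp e =>
    have hs : p ∈ φ.source := hb.1
    have hs' : p ∈ ψ.source := hb'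
    refine ⟨normalVec φ (exc p hp e) j, hb.2, fun i hi => ?_⟩
    have h0 : φ p j = 0 := (hφ.mem_iff p hs).1 hp j hj
    set w := chi φ S j (exc p hp e) with hwdef
    have hwj : w j = 0 := by rw [hself]; exact h0
    let y : Fin n → ℂ := fun h => if h = j then 1 else if h ∈ S then w h else 0
    obtain ⟨v₁, hv₁⟩ := (mdifferentiable_adaptedChart hφ.mem_maximalAtlas).mfderiv_surjective hs y
    set v : TangentSpace 𝓘(ℂ, Fin n → ℂ) p := Quotient.out e.rep with hv
    set c : ℂ := normalVec φ (exc p hp e) j with hc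
    have hcj : mfderiv 𝓘(ℂ, Fin n → ℂ) 𝓘(ℂ, Fin n → ℂ) φ p v j = c := rfl
    have hker : v - c • v₁ ∈ LinearMap.ker (normalLin φ S p) := by
      refine LinearMap.mem_ker.2 (funext fun h => ?_)
      change mfderiv 𝓘(ℂ, Fin n → ℂ) 𝓘(ℂ, Fin n → ℂ) φ p (v - c • v₁) h = 0
      rw [map_sub, map_smul, hv₁]
      change mfderiv 𝓘(ℂ, Fin n → ℂ) 𝓘(ℂ, Fin n → ℂ) φ p v h - c * y h = 0
      by_cases hhj : (h : Fin n) = j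
      · rw [hhj, hcj]; simp [y]
      · have h1 : w h = mfderiv 𝓘(ℂ, Fin n → ℂ) 𝓘(ℂ, Fin n → ℂ) φ p v h / c :=
          chi_ratio (exc p hp e) h.2 hhj
        have h2 : c ≠ 0 := hb.2
        simp only [y, hhj, if_false, h.2, if_true, h1]
        field_simp
        simp
    rw [ker_normalLin hφ hs hp, ← ker_normalLin hψ hs' hp] at hker
    have h3 : mfderiv 𝓘(ℂ, Fin n → ℂ) 𝓘(ℂ, Fin n → ℂ) ψ p (v - c • v₁) i = 0 :=
      congrFun (LinearMap.mem_ker.1 hker) ⟨i, hi⟩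
    rw [map_sub, map_smul] at h3
    have h4 : mfderiv 𝓘(ℂ, Fin n → ℂ) 𝓘(ℂ, Fin n → ℂ) ψ p v i =
        c * mfderiv 𝓘(ℂ, Fin n → ℂ) 𝓘(ℂ, Fin n → ℂ) ψ p v₁ i := sub_eq_zero.1 h3
    change mfderiv 𝓘(ℂ, Fin n → ℂ) 𝓘(ℂ, Fin n → ℂ) ψ p v i = _
    rw [h4, mfderiv_transition hφ.mem_maximalAtlas hψ.mem_maximalAtlas hs hs', hv₁]
    congr 1
    -- both sides are derivatives of the same function along a line
    have hβ' : beta S j w = φ p := hβ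
    have hτ : HasFDerivAt (fun x => ψ (φ.symm x)) (fderiv ℂ (fun x => ψ (φ.symm x)) (φ p)) (φ p) :=
      (analyticAt_transition hφ.mem_maximalAtlas hψ.mem_maximalAtlas (φ.map_source hs)
        (by rwa [φ.left_inv hs])).differentiableAt.hasFDerivAt
    have hprojd : ∀ z : Fin n → ℂ, HasFDerivAt (fun x : Fin n → ℂ => x i)
        (ContinuousLinearMap.proj (R := ℂ) (φ := fun _ : Fin n => ℂ) i) z := fun z =>
      (ContinuousLinearMap.proj (R := ℂ) (φ := fun _ : Fin n => ℂ) i).hasFDerivAt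
    have hl : HasDerivAt (fun t : ℂ => beta S j w + t • y) y 0 := by
      simpa using ((hasDerivAt_id (0 : ℂ)).smul_const y).const_add (beta S j w)
    have hA : HasDerivAt (fun t : ℂ => ψ (φ.symm (beta S j w + t • y)) i)
        (fderiv ℂ (fun x => ψ (φ.symm x)) (φ p) y i) 0 := by
      have hτ' : HasFDerivAt (fun x => ψ (φ.symm x)) (fderiv ℂ (fun x => ψ (φ.symm x)) (φ p))
          (beta S j w + (0 : ℂ) • y) := by simpa [hβ'] using hτ
      have hin : HasDerivAt (fun t : ℂ => ψ (φ.symm (beta S j w + t • y)))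
          (fderiv ℂ (fun x => ψ (φ.symm x)) (φ p) y) 0 :=
        HasFDerivAt.comp_hasDerivAt (l := fun x => ψ (φ.symm x))
          (f := fun t : ℂ => beta S j w + t • y) (0 : ℂ) hτ' hl
      exact (hprojd _).comp_hasDerivAt (0 : ℂ) hin
    have hl2 : HasDerivAt (fun t : ℂ => w + t • (Pi.single j 1 : Fin n → ℂ)) (Pi.single j 1) 0 := by
      simpa using ((hasDerivAt_id (0 : ℂ)).smul_const (Pi.single j 1 : Fin n → ℂ)).const_add w
    have hg : HasFDerivAt (fun x => ψ (φ.symm (beta S j x)) i)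
        (fderiv ℂ (fun x => ψ (φ.symm (beta S j x)) i) w) (w + (0 : ℂ) • Pi.single j 1) := by
      have := analyticAt_pullback hφ.mem_maximalAtlas hψ.mem_maximalAtlas hw (by rw [hinv]; exact hs')
      have h5 : AnalyticAt ℂ (fun x => ψ (φ.symm (beta S j x)) i) w :=
        ((ContinuousLinearMap.proj (R := ℂ) (φ := fun _ : Fin n => ℂ) i).analyticAt _).comp this
      have h6 := h5.differentiableAt.hasFDerivAt
      rwa [zero_smul, add_zero]
    have hB := hg.comp_hasDerivAt (0 : ℂ) hl2
    have hfun : (fun x => ψ (φ.symm (beta S j x)) i) ∘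
        (fun t : ℂ => w + t • (Pi.single j 1 : Fin n → ℂ)) =
        (fun t : ℂ => ψ (φ.symm (beta S j w + t • y)) i) := by
      funext t
      simp only [Function.comp]
      rw [beta_add_single]
    rw [hfun] at hB
    rw [hA.unique hB]
    simp [homCoord, hwj]

/-- The charts of the blow-up: the charts `(V_j, χ_j)` given by the adapted charts of `M`, and the
charts of `M ∖ X`. -/
def charts (X : ClosedSubmanifold n M r) : Set (PartialEquiv (BlowUp X) (Fin n → ℂ)) :=
  {e | ∃ (φ : OpenPartialHomeomorph M (Fin n → ℂ)) (S : Finset (Fin n)) (j : Fin n),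
    IsAdapted r X.carrier φ S ∧ j ∈ S ∧
      e.source = chiSource X φ j ∧ e.target = chiTarget φ S j ∧ ⇑e = chi φ S j} ∪
  {e | ∃ φ ∈ IsManifold.maximalAtlas 𝓘(ℂ, Fin n → ℂ) ω M,
    e.source = proj ⁻¹' (φ.source \ X.carrier) ∧
      e.target = φ.target ∩ φ.symm ⁻¹' X.carrierᶜ ∧ ⇑e = fun b => φ (proj b)}

theorem normalVec_of_notMem {b : BlowUp X} (hb : proj b ∉ X.carrier) :
    normalVec φ b = φ (proj b) := by
  cases b with
  | pt q hq => rfl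
  | exc p hp e => exact absurd hp hb

theorem charts_left {e : PartialEquiv (BlowUp X) (Fin n → ℂ)} (he : e ∈ charts X) :
    IsOpen e.target ∧ ∀ w ∈ e.target,
      ContinuousAt (fun x => proj (e.symm x)) w ∧
      (∀ ψ ∈ IsManifold.maximalAtlas 𝓘(ℂ, Fin n → ℂ) ω M, proj (e.symm w) ∈ ψ.source →
        AnalyticAt ℂ (fun x => ψ (proj (e.symm x))) w) ∧
      (∀ ψ T, IsAdapted r X.carrier ψ T → proj (e.symm w) ∈ ψ.source →
        ∃ Q : (Fin n → ℂ) → Fin n → ℂ, (∀ i ∈ T, AnalyticAt ℂ (fun x => Q x i) w) ∧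
          ∀ᶠ x in 𝓝 w, ∃ c : ℂ, c ≠ 0 ∧ ∀ i ∈ T, normalVec ψ (e.symm x) i = c * Q x i) := by
  rcases he with ⟨φ, S, j, hφ, hj, hs, ht, hf⟩ | ⟨φ, hφ, hs, ht, hf⟩
  · have hopen : IsOpen e.target := by rw [ht]; exact isOpen_chiTarget
    have hchi : ∀ w ∈ e.target, chi φ S j (e.symm w) = w := by
      intro w hw; rw [← hf]; exact e.right_inv hw
    have hsrc : ∀ w ∈ e.target, e.symm w ∈ chiSource X φ j := by
      intro w hw; rw [← hs]; exact e.map_target hw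
    have hinv : ∀ w ∈ e.target, proj (e.symm w) = φ.symm (beta S j w) := by
      intro w hw
      have := beta_chi hφ hj (hsrc w hw)
      rw [hchi w hw] at this
      rw [this, φ.left_inv (hsrc w hw).1]
    have hev : ∀ w ∈ e.target, (fun x => φ.symm (beta S j x)) =ᶠ[𝓝 w]
        (fun x => proj (e.symm x)) := by
      intro w hw
      filter_upwards [hopen.mem_nhds hw] with x hx
      exact (hinv x hx).symm
    refine ⟨hopen, fun w hw => ?_⟩
    have hw' : w ∈ chiTarget φ S j := by rw [← ht]; exact hw
    have hcont : ContinuousAt (fun x => proj (e.symm x)) w :=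
      (ContinuousAt.comp (f := beta S j) (φ.continuousAt_symm hw')
        (analyticAt_beta S j w).continuousAt).congr (hev w hw)
    refine ⟨hcont, fun ψ hψ hp => ?_, fun ψ T hψ hp => ?_⟩
    · rw [hinv w hw] at hp
      exact (analyticAt_pullback hφ.mem_maximalAtlas hψ hw' hp).congr
        ((hev w hw).mono fun x hx => congrArg ψ hx)
    · refine ⟨homCoord φ ψ S j, fun i hi => ?_, ?_⟩
      · rw [hinv w hw] at hp
        exact analyticAt_homCoord hφ hψ hw' hp hi
      · filter_upwards [hopen.mem_nhds hw, hcont (ψ.open_source.mem_nhds hp)] with x hx hx'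
        have := normalVec_eq_homCoord hφ hψ hj (hsrc x hx) hx'
        rwa [hchi x hx] at this
  · have hopen : IsOpen e.target := by
      rw [ht]
      exact φ.continuousOn_symm.isOpen_inter_preimage φ.open_target X.isClosed.isOpen_compl
    have hsrc : ∀ w ∈ e.target, proj (e.symm w) ∈ φ.source \ X.carrier := by
      intro w hw
      have := e.map_target hw
      rw [hs] at this
      exact this
    have hinv : ∀ w ∈ e.target, proj (e.symm w) = φ.symm w := by
      intro w hw
      have h1 : φ (proj (e.symm w)) = w := by
        have := e.right_inv hw
        rwa [hf] at this
      rw [← φ.left_inv (hsrc w hw).1, h1]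
    have hev : ∀ w ∈ e.target, (fun x => φ.symm x) =ᶠ[𝓝 w] (fun x => proj (e.symm x)) := by
      intro w hw
      filter_upwards [hopen.mem_nhds hw] with x hx
      exact (hinv x hx).symm
    refine ⟨hopen, fun w hw => ?_⟩
    have hw' : w ∈ φ.target := by
      rw [ht] at hw; exact hw.1
    have hA : ∀ ψ ∈ IsManifold.maximalAtlas 𝓘(ℂ, Fin n → ℂ) ω M, proj (e.symm w) ∈ ψ.source →
        AnalyticAt ℂ (fun x => ψ (proj (e.symm x))) w := by
      intro ψ hψ hp
      rw [hinv w hw] at hp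
      exact (analyticAt_transition hφ hψ hw' hp).congr
        ((hev w hw).mono fun x hx => congrArg ψ hx)
    refine ⟨(φ.continuousAt_symm hw').congr (hev w hw), hA, fun ψ T hψ hp => ?_⟩
    refine ⟨fun x => ψ (proj (e.symm x)), fun i _ => ?_, ?_⟩
    · exact ((ContinuousLinearMap.proj (R := ℂ) (φ := fun _ : Fin n => ℂ) i).analyticAt _).comp
        (hA ψ hψ.mem_maximalAtlas hp)
    · filter_upwards [hopen.mem_nhds hw] with x hx
      refine ⟨1, one_ne_zero, fun i _ => ?_⟩
      rw [normalVec_of_notMem (hsrc x hx).2, one_mul]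

theorem charts_transition {e e' : PartialEquiv (BlowUp X) (Fin n → ℂ)} (he : e ∈ charts X)
    (he' : e' ∈ charts X) {w : Fin n → ℂ} (hw : w ∈ (e.symm.trans e').source) :
    (e.symm.trans e').source ∈ 𝓝 w ∧ AnalyticAt ℂ (e.symm.trans e') w := by
  obtain ⟨hopen, hall⟩ := charts_left he
  have hw1 : w ∈ e.target := hw.1
  have hw2 : e.symm w ∈ e'.source := hw.2
  obtain ⟨hcont, hA, hQ⟩ := hall w hw1
  have hp : ∀ h : Fin n, ∀ w, AnalyticAt ℂ (fun w : Fin n → ℂ => w h) w := fun h w =>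
    (ContinuousLinearMap.proj (R := ℂ) (φ := fun _ : Fin n => ℂ) h).analyticAt w
  rcases he' with ⟨ψ, T, k, hψ, hk, hs, ht, hf⟩ | ⟨ψ, hψ, hs, ht, hf⟩
  · rw [hs] at hw2
    obtain ⟨Q, hQa, hQe⟩ := hQ ψ T hψ hw2.1
    have hQk : Q w k ≠ 0 := by
      obtain ⟨c, hc, hcQ⟩ := hQe.self_of_nhds
      have := hw2.2
      rw [hcQ k hk] at this
      exact right_ne_zero_of_mul this
    have hne : ∀ᶠ x in 𝓝 w, Q x k ≠ 0 := (hQa k hk).continuousAt.eventually_ne hQk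
    constructor
    · filter_upwards [hopen.mem_nhds hw1, hcont (ψ.open_source.mem_nhds hw2.1), hQe, hne]
        with x hx1 hx2 ⟨c, hc, hcQ⟩ hx3
      refine ⟨hx1, ?_⟩
      change e.symm x ∈ e'.source
      rw [hs]
      refine ⟨hx2, ?_⟩
      rw [hcQ k hk]
      exact mul_ne_zero hc hx3
    · have hcoe : (⇑(e.symm.trans e') : (Fin n → ℂ) → Fin n → ℂ) =
          fun x => chi ψ T k (e.symm x) := by
        funext x
        rw [← hf]; rfl
      rw [hcoe]
      refine AnalyticAt.pi fun h => ?_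
      by_cases hh : h ∈ T ∧ h ≠ k
      · refine ((hQa h hh.1).div (hQa k hk) hQk).congr ?_
        filter_upwards [hQe] with x ⟨c, hc, hcQ⟩
        rw [chi_ratio _ hh.1 hh.2, hcQ k hk, hcQ h hh.1, mul_div_mul_left _ _ hc]
        rfl
      · have : (fun x => chi ψ T k (e.symm x) h) = fun x => ψ (proj (e.symm x)) h := by
          funext x; simp only [chi, hh, if_false]
        rw [this]
        exact (hp h _).comp (hA ψ hψ.mem_maximalAtlas hw2.1)
  · rw [hs] at hw2
    constructor
    · filter_upwards [hopen.mem_nhds hw1, hcont (ψ.open_source.mem_nhds hw2.1),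
        hcont (X.isClosed.isOpen_compl.mem_nhds hw2.2)] with x hx1 hx2 hx3
      refine ⟨hx1, ?_⟩
      change e.symm x ∈ e'.source
      rw [hs]
      exact ⟨hx2, hx3⟩
    · have hcoe : (⇑(e.symm.trans e') : (Fin n → ℂ) → Fin n → ℂ) =
          fun x => ψ (proj (e.symm x)) := by
        funext x
        change e' (e.symm x) = _
        rw [hf]
      rw [hcoe]
      exact hA ψ hψ hw2.1

theorem bijOn_offX (φ : OpenPartialHomeomorph M (Fin n → ℂ)) :
    Set.BijOn (fun b : BlowUp X => φ (proj b)) (proj ⁻¹' (φ.source \ X.carrier))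
      (φ.target ∩ φ.symm ⁻¹' X.carrierᶜ) := by
  refine ⟨fun b hb => ⟨φ.map_source hb.1, ?_⟩, fun b hb b' hb' h => ?_, fun w hw => ?_⟩
  · change φ.symm (φ (proj b)) ∉ X.carrier
    rw [φ.left_inv hb.1]; exact hb.2
  · have h2 : proj b = proj b' := φ.injOn hb.1 hb'.1 h
    cases b with
    | exc p hp e => exact absurd hp hb.2
    | pt q hq =>
      cases b' with
      | exc p hp e => exact absurd hp hb'.2
      | pt q' hq' => simp only [proj] at h2; subst h2; rfl
  · exact ⟨pt (φ.symm w) hw.2, ⟨φ.map_target hw.1, hw.2⟩, φ.right_inv hw.1⟩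

theorem exists_chart [IsManifold 𝓘(ℂ, Fin n → ℂ) ω M] (b : BlowUp X) :
    ∃ e ∈ charts X, b ∈ e.source := by
  have : Nonempty (BlowUp X) := ⟨b⟩
  cases b with
  | pt q hq =>
    refine ⟨(bijOn_offX (chartAt (Fin n → ℂ) q)).toPartialEquiv, Or.inr ⟨_,
      IsManifold.chart_mem_maximalAtlas q, rfl, rfl, rfl⟩, mem_chart_source _ q, hq⟩
  | exc p hp e =>
    obtain ⟨φ, S, hφ, hps⟩ := X.exists_adapted p hp
    induction e using Projectivization.ind with
    | h u hu =>
    obtain ⟨c, hc, hcu⟩ := normalVec_exc hφ hps hp u hu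
    have : ∃ j : S, normalEquiv hφ hps hp u j ≠ 0 := by
      by_contra! h
      exact hu ((normalEquiv hφ hps hp).map_eq_zero_iff.1 (funext h))
    obtain ⟨⟨j, hj⟩, hne⟩ := this
    refine ⟨(bijOn_chi hφ hj).toPartialEquiv, Or.inl ⟨φ, S, j, hφ, hj, rfl, rfl, rfl⟩, hps, ?_⟩
    rw [hcu j hj]
    exact mul_ne_zero hc hne

variable [IsManifold 𝓘(ℂ, Fin n → ℂ) ω M]

/-- The charts `charts X`, as an atlas on the bare set `BlowUp X`. -/
noncomputable def core (X : ClosedSubmanifold n M r) :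
    ChartedSpaceCore (Fin n → ℂ) (BlowUp X) where
  atlas := charts X
  chartAt b := (exists_chart b).choose
  mem_chart_source b := (exists_chart b).choose_spec.2
  chart_mem_atlas b := (exists_chart b).choose_spec.1
  open_source _ _ he he' :=
    isOpen_iff_mem_nhds.2 fun _ hw => (charts_transition he he' hw).1
  continuousOn_toFun _ _ he he' := fun _ hw =>
    (charts_transition he he' hw).2.continuousAt.continuousWithinAt

/-- The topology of the blow-up, for which the charts are homeomorphisms between open sets. -/
noncomputable instance (X : ClosedSubmanifold n M r) : TopologicalSpace (BlowUp X) :=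
  (core X).toTopologicalSpace

/-- The charted space structure of the blow-up. -/
noncomputable instance (X : ClosedSubmanifold n M r) : ChartedSpace (Fin n → ℂ) (BlowUp X) :=
  (core X).toChartedSpace

/-- The blow-up is a complex manifold. -/
instance (X : ClosedSubmanifold n M r) : IsManifold 𝓘(ℂ, Fin n → ℂ) ω (BlowUp X) := by
  apply isManifold_of_contDiffOn
  intro e e' he he'
  obtain ⟨f, hf⟩ := Set.mem_iUnion.1 he
  obtain ⟨hf1, hf2⟩ := Set.mem_iUnion.1 hf
  obtain ⟨f', hf'⟩ := Set.mem_iUnion.1 he'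
  obtain ⟨hf1', hf2'⟩ := Set.mem_iUnion.1 hf'
  rw [Set.mem_singleton_iff] at hf2 hf2'
  subst hf2 hf2'
  intro w hw
  have hw' : w ∈ (f.symm.trans f').source := by
    have h := hw.1
    exact ⟨h.1, h.2⟩
  exact (charts_transition hf1 hf1' hw').2.contDiffAt.contDiffWithinAt

end BlowUp

/-- `F` represents an element of `End(N, Y)`: the germ of `F` along `Y` is holomorphic, and `F` maps
`Y` into itself. Two such maps represent the same element iff they agree on a neighbourhood
of `Y`, that is, iff `F =ᶠ[𝓝ˢ Y] F'`. -/
structure IsHolSelfGerm (n : ℕ) {N : Type*} [TopologicalSpace N] [ChartedSpace (Fin n → ℂ) N]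
    (Y : Set N) (F : N → N) : Prop where
  holomorphic : ∀ᶠ q in 𝓝ˢ Y, ContMDiffAt 𝓘(ℂ, Fin n → ℂ) 𝓘(ℂ, Fin n → ℂ) ω F q
  mapsTo : Set.MapsTo F Y Y

open Classical in
/-- The inclusion of the normal coordinates `ℂ^S`, `z'' ↦ (0, z'')`. -/
noncomputable def extendNormal (S : Finset (Fin n)) (v : S → ℂ) : Fin n → ℂ :=
  fun h => if hh : h ∈ S then v ⟨h, hh⟩ else 0

/-- The normal part `(P_{l, φ(p)'}(v))''` of the `l`-th term of the expansion
`G(z', z'') = ∑_l P_{l, z'}(z'')` of `G = ψ ∘ F ∘ φ⁻¹` in homogeneous polynomials in `z''`, at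
`z' = φ(p)'`: the coefficient of `ζ^l` in the power series of `ζ ↦ G(φ(p)', ζ v)''`. -/
noncomputable def normalTerm (φ : OpenPartialHomeomorph M (Fin n → ℂ)) (S : Finset (Fin n))
    (ψ : OpenPartialHomeomorph M (Fin n → ℂ)) (T : Finset (Fin n)) (F : M → M) (p : M) (l : ℕ)
    (v : S → ℂ) : T → ℂ := fun i =>
  (l.factorial : ℂ)⁻¹ *
    iteratedDeriv l (fun ζ : ℂ => ψ (F (φ.symm (φ p + ζ • extendNormal S v))) i) 0

/-- `min {l | (P_{l, φ(p)'})'' ≢ 0}`, with value `∞` if there is no such `l`. -/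
noncomputable def chartOrder (φ : OpenPartialHomeomorph M (Fin n → ℂ)) (S : Finset (Fin n))
    (ψ : OpenPartialHomeomorph M (Fin n → ℂ)) (T : Finset (Fin n)) (F : M → M) (p : M) : ℕ∞ :=
  ⨅ (l : ℕ) (_ : ∃ v, normalTerm φ S ψ T F p l v ≠ 0), (l : ℕ∞)

/-- The order `ν_X(F, p)` of `F` at `p` along `X`. It is the minimum of the orders computed in
charts adapted to `X` at `p` and at `F p`; if one of them equals the minimum of the orders
over `p ∈ X`, then so do all of them. -/
noncomputable def orderAt (X : ClosedSubmanifold n M r) (F : M → M) (p : M) : ℕ∞ :=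
  ⨅ (φ : OpenPartialHomeomorph M (Fin n → ℂ)) (S : Finset (Fin n))
    (ψ : OpenPartialHomeomorph M (Fin n → ℂ)) (T : Finset (Fin n))
    (_ : IsAdapted r X.carrier φ S) (_ : IsAdapted r X.carrier ψ T)
    (_ : p ∈ φ.source) (_ : F p ∈ ψ.source), chartOrder φ S ψ T F p

/-- The order `ν_X(F) = min {ν_X(F, p) | p ∈ X}` of `F` along `X`. -/
noncomputable def order (X : ClosedSubmanifold n M r) (F : M → M) : ℕ∞ :=
  ⨅ p ∈ X.carrier, orderAt X F p

/-- `F` is non-degenerate at `p` along `X`. If `ν_X(F) = ∞` and `r < n` then the condition `leading`,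
read with `∞.toNat = 0`, fails, since the normal part of `P_0` vanishes on `X`. -/
structure IsNondegenerateAt (X : ClosedSubmanifold n M r) (F : M → M) (p : M) : Prop where
  preimage : ∀ᶠ q in 𝓝ˢ X.carrier, F q = p → q ∈ X.carrier
  order_eq : orderAt X F p = order X F
  leading : ∃ (φ : OpenPartialHomeomorph M (Fin n → ℂ)) (S : Finset (Fin n))
    (ψ : OpenPartialHomeomorph M (Fin n → ℂ)) (T : Finset (Fin n)),
    IsAdapted r X.carrier φ S ∧ IsAdapted r X.carrier ψ T ∧ p ∈ φ.source ∧ F p ∈ ψ.source ∧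
      ∀ v, normalTerm φ S ψ T F p (order X F).toNat v = 0 ↔ v = 0

/-- `F` is non-degenerate along `X`. -/
def IsNondegenerate (X : ClosedSubmanifold n M r) (F : M → M) : Prop :=
  ∀ p ∈ X.carrier, IsNondegenerateAt X F p

/-- `G`, a germ along the exceptional divisor, is a lift of `F` to the blow-up: it belongs to
`End(M̃_X, E_X)`, and `F ∘ σ = σ ∘ G` near `E_X`. -/
structure IsLift [IsManifold 𝓘(ℂ, Fin n → ℂ) ω M] (X : ClosedSubmanifold n M r) (F : M → M)
    (G : BlowUp X → BlowUp X) : Prop where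
  isHolSelfGerm : IsHolSelfGerm n (BlowUp.excDivisor X) G
  comm : ∀ᶠ b in 𝓝ˢ (BlowUp.excDivisor X), F (BlowUp.proj b) = BlowUp.proj (G b)

end

end HolBlowUp

open HolBlowUp

namespace HolBlowUp

/-! In the coordinates `χ_j` the projection `σ` becomes `beta`: each normal coordinate other than
the `j`-th is multiplied by `w_j`, and `E_X` is `{w_j = 0}`. A line in the direction `e_j` through a
point of `E_X` is sent to a line in a normal direction, along which the polynomials `P_m` are Taylor
coefficients. With `l` the order of `F`, all `P_m''` with `m < l` vanish in all adapted charts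
(`vanishesToOrder_order`), so every normal coordinate of `ψ ∘ F ∘ σ` is divisible by `w_j ^ l`. The
quotient `leadCoord` is holomorphic (`analyticAt_divPow`, `analyticAt_leadCoord`), and on `E_X` it
is `P_l''` at the representative whose `j`-th entry is 1. These quotients are the homogeneous
coordinates of the lift, both on `E_X` and off it.

The leading term is known to be nonzero only in one pair of adapted charts at each point.
`leadCoord_change_source` and `IsLeadValue.change_target` carry this to every pair: off `E_X` the
quotients in two pairs of charts differ by a common nonzero factor and the transition of homogeneous
coordinates, and the relation extends to `E_X` by continuity, the complement of `E_X` being dense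
(`frequently_notMem`). In the charts `χ_j` and `χ_k` the lift is then given by ratios of holomorphic
functions with nonzero denominator, hence is holomorphic.

A nonzero quotient also forces `F` to map points off `X`, close to the point considered, off `X`;
there a lift is determined by `F`, as `σ` is injective off `E_X`. On `E_X` two lifts agree as limits
from the complement, because points of one fibre are separated (`eq_of_le_nhds`). The formula on
`E_X` is the direction from which the lift was built, read in arbitrary charts
(`IsLeadingLift.apply_exc`). -/

/-! ### Taylor coefficients along a line and division by powers of a coordinate -/

theorem iteratedDeriv_comp_mul_left (c : ℂ) (f : ℂ → ℂ) (l : ℕ) :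
    iteratedDeriv l (fun x => f (c * x)) = fun x => c ^ l * iteratedDeriv l f (c * x) := by
  induction l with
  | zero => simp
  | succ l ih =>
    funext x
    rw [iteratedDeriv_succ, ih, deriv_const_mul_field, deriv_comp_mul_left, iteratedDeriv_succ,
      smul_eq_mul, pow_succ, mul_assoc]

/-- In the Leibniz formula at 0 only the term with exactly one derivative on the factor `ζ`
survives. -/
theorem iteratedDeriv_succ_id_mul {f : ℂ → ℂ} (hf : AnalyticAt ℂ f 0) (l : ℕ) :
    iteratedDeriv (l + 1) (fun ζ => ζ * f ζ) 0 = (l + 1) * iteratedDeriv l f 0 := by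
  rw [iteratedDeriv_fun_mul (f := fun ζ : ℂ => ζ) contDiffAt_id hf.contDiffAt,
    Finset.sum_eq_single_of_mem 1 (by simp)]
  · simp [iteratedDeriv_fun_id_zero]
  · intro i _ hi
    simp [iteratedDeriv_fun_id_zero, hi]

open Classical in
/-- The quotient `g / w_j ^ l`, extended to `w_j = 0` by the `l`-th Taylor coefficient of `g` in the
direction `j`. -/
noncomputable def divPow {n : ℕ} (g : (Fin n → ℂ) → ℂ) (j : Fin n) (l : ℕ) (w : Fin n → ℂ) : ℂ :=
  if w j = 0 then (l.factorial : ℂ)⁻¹ *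
    iteratedDeriv l (fun ζ : ℂ => g (w + ζ • Pi.single j 1)) 0
  else g w / w j ^ l

theorem eq_pow_mul_divPow {n : ℕ} (g : (Fin n → ℂ) → ℂ) (j : Fin n) (l : ℕ) {w : Fin n → ℂ}
    (hw : w j ≠ 0) : g w = w j ^ l * divPow g j l w := by
  simp only [divPow, hw, if_false]
  field_simp

/-- Repeated division by `w_j`: each division (`analyticAt_divCoord`) lowers by one the vanishing
order along the hyperplane, so the hypothesis passes to the quotient with `l` replaced by `l - 1`.
-/
theorem analyticAt_divPow {n : ℕ} {g : (Fin n → ℂ) → ℂ} {w₀ : Fin n → ℂ} (j : Fin n) (l : ℕ)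
    (hg : AnalyticAt ℂ g w₀)
    (h0 : ∀ᶠ w in 𝓝 w₀, w j = 0 → ∀ m < l,
      iteratedDeriv m (fun ζ : ℂ => g (w + ζ • Pi.single j 1)) 0 = 0) :
    AnalyticAt ℂ (divPow g j l) w₀ := by
  classical
  -- Away from the hyperplane `divPow` is an ordinary quotient with nonzero denominator.
  by_cases hj : w₀ j = 0
  swap
  · have hp := (ContinuousLinearMap.proj (R := ℂ) (φ := fun _ : Fin n => ℂ) j).analyticAt w₀
    refine (hg.div (hp.pow l) (pow_ne_zero l hj)).congr ?_
    filter_upwards [hp.continuousAt.eventually_ne hj] with x hx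
    have hx' : x j ≠ 0 := hx
    simp [divPow, hx']
  induction l generalizing g with
  | zero =>
    refine hg.congr (Filter.Eventually.of_forall fun w => ?_)
    simp [divPow]
  | succ l ih =>
    have hz : ∀ᶠ w in 𝓝 w₀, w j = 0 → g w = 0 := by
      filter_upwards [h0] with w hw hwj
      simpa using hw hwj 0 l.succ_pos
    have hg₁ := analyticAt_divCoord j hg hj hz
    set g₁ : (Fin n → ℂ) → ℂ :=
      fun w => if w j = 0 then fderiv ℂ g w (Pi.single j 1) else g w / w j with hg₁def
    -- Along a line in the direction `e_j` starting on the hyperplane `g = ζ * g₁`, so the Taylor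
    -- coefficients of `g` are those of `g₁` shifted by one.
    have key : ∀ᶠ w in 𝓝 w₀, w j = 0 → ∀ m,
        iteratedDeriv (m + 1) (fun ζ : ℂ => g (w + ζ • Pi.single j 1)) 0 =
          (m + 1) * iteratedDeriv m (fun ζ : ℂ => g₁ (w + ζ • Pi.single j 1)) 0 := by
      filter_upwards [hz, hg₁.eventually_analyticAt] with w hw hwa hwj m
      have hline : AnalyticAt ℂ (fun ζ : ℂ => w + ζ • (Pi.single j 1 : Fin n → ℂ)) 0 := by
        fun_prop
      have ha : AnalyticAt ℂ (fun ζ : ℂ => g₁ (w + ζ • Pi.single j 1)) 0 := by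
        refine AnalyticAt.comp (g := g₁) (f := fun ζ : ℂ => w + ζ • Pi.single j 1) ?_ hline
        simpa using hwa
      rw [← iteratedDeriv_succ_id_mul ha]
      congr 1
      funext ζ
      -- The identity `g = ζ * g₁` holds for every `ζ`: for `ζ ≠ 0` by definition of `g₁`, for `ζ =
      -- 0` because `g` vanishes on the hyperplane.
      by_cases hζ : ζ = 0
      · simp [hζ, hw hwj]
      · simp only [hg₁def, Pi.add_apply, hwj, Pi.smul_apply, Pi.single_eq_same, smul_eq_mul,
          mul_one, zero_add, hζ, if_false]
        field_simp
    refine (ih hg₁ ?_).congr ?_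
    · filter_upwards [h0, key] with w hw hk hwj m hm
      have h1 := hw hwj (m + 1) (by omega)
      rw [hk hwj] at h1
      exact (mul_eq_zero.1 h1).resolve_left (by exact_mod_cast m.succ_ne_zero)
    · filter_upwards [key] with w hk
      by_cases hwj : w j = 0
      · simp only [divPow, hwj, if_true]
        rw [hk hwj, Nat.factorial_succ]
        have : (l : ℂ) + 1 ≠ 0 := by exact_mod_cast l.succ_ne_zero
        push_cast
        field_simp
      · simp only [divPow, hwj, if_false, hg₁def, pow_succ]
        field_simp

/-! ### The order of vanishing along `X` and homogeneity of the leading term -/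

section

variable {n r : ℕ} {M : Type*} [TopologicalSpace M] [ChartedSpace (Fin n → ℂ) M]

theorem analyticAt_writtenInCharts {φ ψ : OpenPartialHomeomorph M (Fin n → ℂ)} {F : M → M}
    (hφ : φ ∈ IsManifold.maximalAtlas 𝓘(ℂ, Fin n → ℂ) ω M)
    (hψ : ψ ∈ IsManifold.maximalAtlas 𝓘(ℂ, Fin n → ℂ) ω M) {z : Fin n → ℂ}
    (hz : z ∈ φ.target)
    (hF : ContMDiffAt 𝓘(ℂ, Fin n → ℂ) 𝓘(ℂ, Fin n → ℂ) ω F (φ.symm z))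
    (hz' : F (φ.symm z) ∈ ψ.source) :
    AnalyticAt ℂ (fun x => ψ (F (φ.symm x))) z := by
  have h1 := contMDiffAt_symm_of_mem_maximalAtlas hφ hz
  have h2 := contMDiffAt_of_mem_maximalAtlas hψ hz'
  exact (h2.comp z (hF.comp z h1)).contDiffAt.analyticAt

/-- The germ `F` has order at least `l` along `X`, in all adapted charts. -/
def VanishesToOrder (X : ClosedSubmanifold n M r) (F : M → M) (l : ℕ) : Prop :=
  ∀ (φ : OpenPartialHomeomorph M (Fin n → ℂ)) (S : Finset (Fin n))
    (ψ : OpenPartialHomeomorph M (Fin n → ℂ)) (T : Finset (Fin n)),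
    IsAdapted r X.carrier φ S → IsAdapted r X.carrier ψ T →
    ∀ p ∈ X.carrier, p ∈ φ.source → F p ∈ ψ.source →
    ∀ m < l, ∀ v, normalTerm φ S ψ T F p m v = 0

theorem vanishesToOrder_order (X : ClosedSubmanifold n M r) (F : M → M) :
    VanishesToOrder X F (order X F).toNat := by
  intro φ S ψ T hφ hψ p hp hpφ hpψ m hm v
  by_contra hv
  have h1 : chartOrder φ S ψ T F p ≤ m := iInf₂_le m ⟨v, hv⟩
  have h2 : orderAt X F p ≤ chartOrder φ S ψ T F p :=
    (iInf_le_of_le φ <| iInf_le_of_le S <| iInf_le_of_le ψ <| iInf_le_of_le T <|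
      iInf_le_of_le hφ <| iInf_le_of_le hψ <| iInf_le_of_le hpφ <| iInf_le_of_le hpψ le_rfl)
  have h3 : order X F ≤ orderAt X F p := iInf₂_le p hp
  -- The bound by a natural number makes the order finite. If the order were `∞`, its `toNat` would
  -- be 0 and no `m` would be in question.
  have h4 := ENat.toNat_le_of_le_natCast (h3.trans (h2.trans h1))
  omega

set_option linter.unusedSectionVars false in
theorem normalTerm_smul (φ : OpenPartialHomeomorph M (Fin n → ℂ)) (S : Finset (Fin n))
    (ψ : OpenPartialHomeomorph M (Fin n → ℂ)) (T : Finset (Fin n)) (F : M → M) (p : M) (l : ℕ)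
    (c : ℂ) (v : S → ℂ) :
    normalTerm φ S ψ T F p l (c • v) = c ^ l • normalTerm φ S ψ T F p l v := by
  funext i
  have h1 : ∀ ζ : ℂ, ζ • extendNormal S (c • v) = (c * ζ) • extendNormal S v := by
    intro ζ; funext h
    by_cases hh : h ∈ S
    · simp [extendNormal, hh]; ring
    · simp [extendNormal, hh]
  have h2 := congrFun (iteratedDeriv_comp_mul_left c
    (fun ζ : ℂ => ψ (F (φ.symm (φ p + ζ • extendNormal S v))) i) l) 0
  simp only [normalTerm, h1, Pi.smul_apply, smul_eq_mul]
  rw [h2, mul_zero]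
  ring

/-! ### Homogeneous coordinates on the fibres and the covering by the `χ_j` -/

namespace BlowUp

variable {X : ClosedSubmanifold n M r} {φ φ₁ ψ ψ₁ : OpenPartialHomeomorph M (Fin n → ℂ)}
  {S S₁ T T₁ : Finset (Fin n)} {j j₁ : Fin n} {F : M → M} {l : ℕ}

theorem eq_of_proj_eq {b b' : BlowUp X} (hb : proj b ∉ X.carrier) (h : proj b = proj b') :
    b = b' := by
  cases b with
  | exc p hp e => exact absurd hp hb
  | pt q hq =>
    cases b' with
    | exc p hp e => simp only [proj] at h; subst h; exact absurd hp hq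
    | pt q' hq' => simp only [proj] at h; subst h; rfl

/-- This allows computing with `normalVec` up to a factor instead of with points of a projective
space; the arbitrary choices of representatives inside `normalVec` are absorbed by `c`. -/
theorem iota_eq_mk_iff (hφ : IsAdapted r X.carrier φ S) {p : M} (hps : p ∈ φ.source)
    (hp : p ∈ X.carrier) (e : ExcFiber n X.carrier p) (v : S → ℂ) (hv : v ≠ 0) :
    iota hφ hps hp e = Projectivization.mk ℂ v hv ↔
      ∃ c : ℂ, c ≠ 0 ∧ ∀ i (hi : i ∈ S), normalVec φ (exc p hp e) i = c * v ⟨i, hi⟩ := by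
  induction e using Projectivization.ind with
  | h u hu =>
  obtain ⟨c, hc, hcu⟩ := normalVec_exc hφ hps hp u hu
  have h1 : iota hφ hps hp (Projectivization.mk ℂ u hu) = Projectivization.mk ℂ v hv ↔
      ∃ a : ℂ, a • v = normalEquiv hφ hps hp u :=
    Projectivization.mk_eq_mk_iff' ℂ _ _ (by simpa using hu) hv
  rw [h1]
  constructor
  · rintro ⟨a, ha⟩
    refine ⟨c * a, mul_ne_zero hc ?_, fun i hi => ?_⟩
    · rintro rfl
      rw [zero_smul] at ha
      exact hu ((normalEquiv hφ hps hp).map_eq_zero_iff.1 ha.symm)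
    · rw [hcu i hi, ← ha]; simp [mul_assoc]
  · rintro ⟨a, ha, hav⟩
    refine ⟨c⁻¹ * a, funext fun i => ?_⟩
    have := (hav i i.2).symm.trans (hcu i i.2)
    simp only [Subtype.coe_eta] at this
    simp only [Pi.smul_apply, smul_eq_mul]
    field_simp
    exact this

/-- Some normal component is nonzero: off `X` because the chart is adapted, on `E_p` because
homogeneous coordinates do not all vanish. -/
theorem exists_mem_chiSource (hφ : IsAdapted r X.carrier φ S) {b : BlowUp X}
    (hb : proj b ∈ φ.source) : ∃ j ∈ S, b ∈ chiSource X φ j := by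
  cases b with
  | pt q hq =>
    have h := (hφ.mem_iff q hb).not.1 hq
    push Not at h
    obtain ⟨j, hj, h⟩ := h
    exact ⟨j, hj, hb, h⟩
  | exc p hp e =>
    have hb : p ∈ φ.source := hb
    obtain ⟨c, hc, hcv⟩ := (iota_eq_mk_iff hφ hb hp e _ (Projectivization.rep_nonzero _)).1
      (Projectivization.mk_rep _).symm
    obtain ⟨j, hj⟩ := Function.ne_iff.1 (Projectivization.rep_nonzero (iota hφ hb hp e))
    exact ⟨j, j.2, hb, by rw [hcv j j.2]; exact mul_ne_zero hc hj⟩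

theorem symm_beta_chi (hφ : IsAdapted r X.carrier φ S) (hj : j ∈ S) {b : BlowUp X}
    (hb : b ∈ chiSource X φ j) : φ.symm (beta S j (chi φ S j b)) = proj b := by
  rw [beta_chi hφ hj hb, φ.left_inv hb.1]

theorem symm_beta_mem (hφ : IsAdapted r X.carrier φ S) {w : Fin n → ℂ}
    (hw : w ∈ chiTarget φ S j) (hwj : w j = 0) : φ.symm (beta S j w) ∈ X.carrier := by
  refine (hφ.mem_iff _ (φ.map_target hw)).2 fun h hh => ?_
  rw [φ.right_inv hw]
  by_cases hhj : h = j
  · simp [beta, hhj, hwj]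
  · simp [beta, hh, hhj, hwj]

set_option linter.unusedSectionVars false in
theorem continuousAt_symm_beta {w : Fin n → ℂ} (hw : w ∈ chiTarget φ S j) :
    ContinuousAt (fun x => φ.symm (beta S j x)) w :=
  ContinuousAt.comp (f := beta S j) (φ.continuousAt_symm hw) (analyticAt_beta S j w).continuousAt

theorem coord_ne_zero_of_notMem {b : BlowUp X} (hb : b ∈ chiSource X φ j)
    (hbX : proj b ∉ X.carrier) : φ (proj b) j ≠ 0 := by
  have := hb.2
  rwa [normalVec_of_notMem hbX] at this

/-! ### The leading term in the coordinates `χ_j` -/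

/-- The coordinate `i` of `ψ ∘ F` in the coordinates `χ_j`, divided by `w_j ^ l`. -/
noncomputable def leadCoord (φ : OpenPartialHomeomorph M (Fin n → ℂ)) (S : Finset (Fin n))
    (j : Fin n) (ψ : OpenPartialHomeomorph M (Fin n → ℂ)) (F : M → M) (l : ℕ) (w : Fin n → ℂ)
    (i : Fin n) : ℂ :=
  divPow (fun x => ψ (F (φ.symm (beta S j x))) i) j l w

-- The reason for the coordinates `χ_j`: `beta` is affine in `w_j`, so derivatives in `w_j` upstairs
-- are the derivatives along normal lines that define `normalTerm`.
set_option linter.unusedSectionVars false in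
open Classical in
theorem line_eq (hj : j ∈ S) {w : Fin n → ℂ} (hw : w ∈ chiTarget φ S j) (ζ : ℂ) :
    beta S j (w + ζ • Pi.single j 1) = φ (φ.symm (beta S j w)) +
      ζ • extendNormal S (fun h => if (h : Fin n) = j then 1 else w h) := by
  rw [beta_add_single, φ.right_inv hw]
  congr 2
  funext h
  by_cases hh : h ∈ S
  · simp [extendNormal, hh]
  · have : h ≠ j := fun h' => hh (h' ▸ hj)
    simp [extendNormal, hh, this]

open Classical in
theorem leadCoord_of_eq_zero (hj : j ∈ S) {w : Fin n → ℂ} (hw : w ∈ chiTarget φ S j)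
    (hwj : w j = 0) (i : T) :
    leadCoord φ S j ψ F l w i = normalTerm φ S ψ T F (φ.symm (beta S j w)) l
      (fun h => if (h : Fin n) = j then 1 else w h) i := by
  simp only [leadCoord, divPow, hwj, if_true, normalTerm, ← line_eq hj hw]

/-- The Taylor coefficients below `l` in the direction `e_j`, at all nearby points of `{w_j = 0}`,
are normal terms of `F` of degree below `l`, which vanish by `hV`. This needs the vanishing at every
point of `X` near the centre, not only at the centre. -/
theorem analyticAt_leadCoord (hV : VanishesToOrder X F l) (hφ : IsAdapted r X.carrier φ S)
    (hψ : IsAdapted r X.carrier ψ T) (hj : j ∈ S) {w : Fin n → ℂ} (hw : w ∈ chiTarget φ S j)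
    (hF : ContMDiffAt 𝓘(ℂ, Fin n → ℂ) 𝓘(ℂ, Fin n → ℂ) ω F (φ.symm (beta S j w)))
    (hw' : F (φ.symm (beta S j w)) ∈ ψ.source) {i : Fin n} (hi : i ∈ T) :
    AnalyticAt ℂ (fun x => leadCoord φ S j ψ F l x i) w := by
  classical
  have hg : AnalyticAt ℂ (fun x => ψ (F (φ.symm (beta S j x)))) w :=
    (analyticAt_writtenInCharts hφ.mem_maximalAtlas hψ.mem_maximalAtlas hw hF hw').comp
      (analyticAt_beta S j w)
  have hgi : AnalyticAt ℂ (fun x => ψ (F (φ.symm (beta S j x))) i) w :=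
    ((ContinuousLinearMap.proj (R := ℂ) (φ := fun _ : Fin n => ℂ) i).analyticAt _).comp hg
  refine analyticAt_divPow j l hgi ?_
  have hc : ContinuousAt (fun x => F (φ.symm (beta S j x))) w :=
    ContinuousAt.comp (f := fun x => φ.symm (beta S j x)) hF.continuousAt
      (continuousAt_symm_beta hw)
  filter_upwards [isOpen_chiTarget.mem_nhds hw, hc (ψ.open_source.mem_nhds hw')]
    with x hx hx' hxj m hm
  have h1 := congrFun (hV φ S ψ T hφ hψ _ (symm_beta_mem hφ hx hxj) (φ.map_target hx) hx' m hm
    (fun h => if (h : Fin n) = j then 1 else x h)) ⟨i, hi⟩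
  simp only [normalTerm, ← line_eq hj hx, Pi.zero_apply] at h1
  have h2 := (mul_eq_zero.1 h1).resolve_left (inv_ne_zero (by exact_mod_cast m.factorial_ne_zero))
  convert h2

theorem coord_comp_eq (hφ : IsAdapted r X.carrier φ S) (hj : j ∈ S) {b : BlowUp X}
    (hb : b ∈ chiSource X φ j) (hbX : proj b ∉ X.carrier) (i : Fin n) :
    ψ (F (proj b)) i = φ (proj b) j ^ l * leadCoord φ S j ψ F l (chi φ S j b) i := by
  have h0 : chi φ S j b j ≠ 0 := by
    rw [chi_self]; exact coord_ne_zero_of_notMem hb hbX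
  have := eq_pow_mul_divPow (fun x => ψ (F (φ.symm (beta S j x))) i) j l h0
  simp only [symm_beta_chi hφ hj hb] at this
  rw [this, chi_self]
  rfl

/-- `leadCoord` sees only the representative with `j`-th entry 1; homogeneity of degree `l` accounts
for the factor `v_j ^ l`. -/
theorem normalTerm_eq_leadCoord (hφ : IsAdapted r X.carrier φ S) (hj : j ∈ S) {p : M}
    (hps : p ∈ φ.source) (hp : p ∈ X.carrier) (e : ExcFiber n X.carrier p)
    (hb : exc p hp e ∈ chiSource X φ j) (v : S → ℂ) (hv : v ≠ 0)
    (he : iota hφ hps hp e = Projectivization.mk ℂ v hv) :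
    v ⟨j, hj⟩ ≠ 0 ∧ ∀ i : T, normalTerm φ S ψ T F p l v i =
      v ⟨j, hj⟩ ^ l * leadCoord φ S j ψ F l (chi φ S j (exc p hp e)) i := by
  classical
  obtain ⟨c, hc, hcv⟩ := (iota_eq_mk_iff hφ hps hp e v hv).1 he
  have hvj : v ⟨j, hj⟩ ≠ 0 := by
    have := hb.2
    rw [hcv j hj] at this
    exact right_ne_zero_of_mul this
  refine ⟨hvj, fun i => ?_⟩
  have hw := (bijOn_chi hφ hj).mapsTo hb
  have hwj : chi φ S j (exc p hp e) j = 0 := by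
    rw [chi_self]; exact (hφ.mem_iff p hps).1 hp j hj
  rw [leadCoord_of_eq_zero hj hw hwj, symm_beta_chi hφ hj hb]
  -- The coordinates `χ_j` of a point of `E_p` are the ratios `v_h / v_j`.
  have hvw : v = v ⟨j, hj⟩ • fun h : S =>
      if (h : Fin n) = j then 1 else chi φ S j (exc p hp e) h := by
    funext h
    by_cases hh : (h : Fin n) = j
    · have : h = ⟨j, hj⟩ := Subtype.ext hh
      subst this; simp
    · simp only [Pi.smul_apply, hh, if_false, smul_eq_mul]
      rw [chi_ratio _ h.2 hh, hcv h h.2, hcv j hj, mul_div_mul_left _ _ hc]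
      field_simp
  conv_lhs => rw [hvw, normalTerm_smul]
  rfl

/-! ### Topology of the blow-up: continuity of `σ` and density of the complement of `E_X` -/

variable [IsManifold 𝓘(ℂ, Fin n → ℂ) ω M]

theorem exists_chiChart (hφ : IsAdapted r X.carrier φ S) (hj : j ∈ S) (b : BlowUp X) :
    ∃ e ∈ IsManifold.maximalAtlas 𝓘(ℂ, Fin n → ℂ) ω (BlowUp X),
      e.source = chiSource X φ j ∧ e.target = chiTarget φ S j ∧ ⇑e = chi φ S j := by
  have : Nonempty (BlowUp X) := ⟨b⟩
  have he : (bijOn_chi hφ hj).toPartialEquiv ∈ (core X).atlas :=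
    Or.inl ⟨φ, S, j, hφ, hj, rfl, rfl, rfl⟩
  refine ⟨(core X).openPartialHomeomorph _ he, IsManifold.subset_maximalAtlas ?_, rfl, rfl, rfl⟩
  exact Set.mem_iUnion.2 ⟨_, Set.mem_iUnion.2 ⟨he, rfl⟩⟩

theorem isOpen_chiSource (hφ : IsAdapted r X.carrier φ S) (hj : j ∈ S) :
    IsOpen (chiSource X φ j) := by
  rcases isEmpty_or_nonempty (BlowUp X) with h | ⟨⟨b⟩⟩
  · rw [Set.eq_empty_of_isEmpty (chiSource X φ j)]; exact isOpen_empty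
  · obtain ⟨e, -, hs, -⟩ := exists_chiChart hφ hj b
    rw [← hs]; exact e.open_source

theorem continuousAt_chi (hφ : IsAdapted r X.carrier φ S) (hj : j ∈ S) {b : BlowUp X}
    (hb : b ∈ chiSource X φ j) : ContinuousAt (chi φ S j) b := by
  obtain ⟨e, -, hs, -, he⟩ := exists_chiChart hφ hj b
  rw [← he]; exact e.continuousAt (by rwa [hs])

theorem continuousAt_proj (hφ : IsAdapted r X.carrier φ S) (hj : j ∈ S) {b : BlowUp X}
    (hb : b ∈ chiSource X φ j) : ContinuousAt (proj : BlowUp X → M) b := by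
  have h := ContinuousAt.comp (f := chi φ S j)
    (continuousAt_symm_beta ((bijOn_chi hφ hj).mapsTo hb)) (continuousAt_chi hφ hj hb)
  refine h.congr ?_
  filter_upwards [(isOpen_chiSource hφ hj).mem_nhds hb] with x hx
  exact symm_beta_chi hφ hj hx

/-- In the chart `χ_j` the divisor is `{w_j = 0}`, and moving in the direction `e_j` leaves it at
once. -/
theorem frequently_notMem (hφ : IsAdapted r X.carrier φ S) (hj : j ∈ S) {b : BlowUp X}
    (hb : b ∈ chiSource X φ j) : ∃ᶠ x in 𝓝 b, proj x ∉ X.carrier := by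
  classical
  by_cases hbX : proj b ∈ X.carrier
  swap
  · intro h
    exact h.self_of_nhds hbX
  obtain ⟨e, -, hs, ht, he⟩ := exists_chiChart hφ hj b
  have hbe : b ∈ e.source := by rwa [hs]
  rw [Filter.Frequently]
  simp only [not_not]
  intro h
  have h1 : Filter.Tendsto e.symm (𝓝 (e b)) (𝓝 b) := by
    have := (e.continuousAt_symm (e.map_source hbe)).tendsto
    rwa [e.left_inv hbe] at this
  have h2 : Filter.Tendsto (fun t : ℂ => e b + t • (Pi.single j 1 : Fin n → ℂ)) (𝓝 0)
      (𝓝 (e b)) := by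
    have : ContinuousAt (fun t : ℂ => e b + t • (Pi.single j 1 : Fin n → ℂ)) 0 := by fun_prop
    simpa [ContinuousAt] using this
  -- If `E_X` filled a neighbourhood of `b`, the `j`-th coordinate `t` would vanish for all small
  -- `t`.
  have h3 : ∀ᶠ t : ℂ in 𝓝 0, t = 0 := by
    filter_upwards [(h1.comp h2).eventually h, h2 (e.open_target.mem_nhds (e.map_source hbe))]
      with t ht1 ht2
    have ht3 := e.map_target ht2
    rw [hs] at ht3
    have h4 := (hφ.mem_iff _ ht3.1).1 ht1 j hj
    rw [← chi_self (φ := φ) (S := S) (j := j), ← he] at h4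
    have h5 : (e b + t • (Pi.single j 1 : Fin n → ℂ)) j = 0 :=
      (congrFun (e.right_inv ht2) j).symm.trans h4
    rw [Pi.add_apply, he, chi_self, (hφ.mem_iff _ hb.1).1 hbX j hj] at h5
    simpa using h5
  have h5 : ∀ᶠ t : ℂ in 𝓝[≠] 0, t = 0 := h3.filter_mono nhdsWithin_le_nhds
  obtain ⟨t, ht1, ht2⟩ := (h5.and self_mem_nhdsWithin).exists
  exact ht2 ht1

/-- Two functions continuous at a limit point of the complement of `E_X`, equal on that complement
nearby, have the same value there. -/
theorem eq_of_eventually_notMem (hφ : IsAdapted r X.carrier φ S) (hj : j ∈ S) {b : BlowUp X}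
    (hb : b ∈ chiSource X φ j) {f g : BlowUp X → ℂ} (hf : ContinuousAt f b)
    (hg : ContinuousAt g b) (h : ∀ᶠ x in 𝓝 b, proj x ∉ X.carrier → f x = g x) : f b = g b := by
  by_contra hne
  refine frequently_notMem hφ hj hb ?_
  filter_upwards [h, (hf.sub hg).eventually_ne (sub_ne_zero.2 hne)] with x hx hx' hxX
  exact hx' (sub_eq_zero.2 (hx hxX))

/-! ### Independence of the leading direction from the adapted charts -/

theorem continuousAt_leadCoord_chi (hV : VanishesToOrder X F l) (hφ : IsAdapted r X.carrier φ S)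
    (hψ : IsAdapted r X.carrier ψ T) (hj : j ∈ S) {b : BlowUp X} (hb : b ∈ chiSource X φ j)
    (hF : ContMDiffAt 𝓘(ℂ, Fin n → ℂ) 𝓘(ℂ, Fin n → ℂ) ω F (proj b))
    (hFb : F (proj b) ∈ ψ.source) {i : Fin n} (hi : i ∈ T) :
    ContinuousAt (fun x => leadCoord φ S j ψ F l (chi φ S j x) i) b := by
  rw [← symm_beta_chi hφ hj hb] at hF hFb
  exact ContinuousAt.comp (f := chi φ S j)
    (analyticAt_leadCoord hV hφ hψ hj ((bijOn_chi hφ hj).mapsTo hb) hF hFb hi).continuousAt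
    (continuousAt_chi hφ hj hb)

theorem continuousAt_homCoord_chi (hφ : IsAdapted r X.carrier φ S)
    (hφ₁ : IsAdapted r X.carrier φ₁ S₁) (hj : j ∈ S) {b : BlowUp X} (hb : b ∈ chiSource X φ j)
    (hb₁ : proj b ∈ φ₁.source) {i : Fin n} (hi : i ∈ S₁) :
    ContinuousAt (fun x => homCoord φ φ₁ S j (chi φ S j x) i) b := by
  rw [← symm_beta_chi hφ hj hb] at hb₁
  exact ContinuousAt.comp (f := chi φ S j)
    (analyticAt_homCoord hφ hφ₁ ((bijOn_chi hφ hj).mapsTo hb) hb₁ hi).continuousAt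
    (continuousAt_chi hφ hj hb)

omit [IsManifold 𝓘(ℂ, Fin n → ℂ) ω M] in
theorem coord_eq_mul_homCoord (hφ : IsAdapted r X.carrier φ S) (hj : j ∈ S) {b : BlowUp X}
    (hb : b ∈ chiSource X φ j) (hbX : proj b ∉ X.carrier) (i : Fin n) :
    φ₁ (proj b) i = φ (proj b) j * homCoord φ φ₁ S j (chi φ S j b) i := by
  have h0 := coord_ne_zero_of_notMem hb hbX
  simp only [homCoord, chi_self, h0, if_false, symm_beta_chi hφ hj hb]
  field_simp

/-- Two local equations of `E_X` differ by a unit: the `j₁`-th coordinate of `φ₁` is that of `φ`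
with index `j` times `homCoord`. Comparing the two factorizations of the same function and
cancelling the `l`-th power gives the factor off `E_X`, and continuity gives it on `E_X`. -/
theorem leadCoord_change_source (hV : VanishesToOrder X F l) (hφ : IsAdapted r X.carrier φ S)
    (hφ₁ : IsAdapted r X.carrier φ₁ S₁) (hψ : IsAdapted r X.carrier ψ T) (hj : j ∈ S)
    (hj₁ : j₁ ∈ S₁) {b : BlowUp X} (hb : b ∈ chiSource X φ j) (hb₁ : b ∈ chiSource X φ₁ j₁)
    (hF : ContMDiffAt 𝓘(ℂ, Fin n → ℂ) 𝓘(ℂ, Fin n → ℂ) ω F (proj b))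
    (hFb : F (proj b) ∈ ψ.source) :
    ∃ c : ℂ, c ≠ 0 ∧ ∀ i ∈ T, leadCoord φ S j ψ F l (chi φ S j b) i =
      c * leadCoord φ₁ S₁ j₁ ψ F l (chi φ₁ S₁ j₁ b) i := by
  have hc := continuousAt_homCoord_chi hφ hφ₁ hj hb hb₁.1 hj₁
  -- The factor is nonzero since `b` lies in the domain of the second chart.
  refine ⟨homCoord φ φ₁ S j (chi φ S j b) j₁ ^ l, pow_ne_zero _ ?_, fun i hi => ?_⟩
  · obtain ⟨c, -, hcv⟩ := normalVec_eq_homCoord hφ hφ₁ hj hb hb₁.1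
    have := hb₁.2
    rw [hcv j₁ hj₁] at this
    exact right_ne_zero_of_mul this
  · refine eq_of_eventually_notMem hφ hj hb
      (f := fun x => leadCoord φ S j ψ F l (chi φ S j x) i)
      (g := fun x => homCoord φ φ₁ S j (chi φ S j x) j₁ ^ l *
        leadCoord φ₁ S₁ j₁ ψ F l (chi φ₁ S₁ j₁ x) i)
      (continuousAt_leadCoord_chi hV hφ hψ hj hb hF hFb hi)
      ((hc.pow l).mul (continuousAt_leadCoord_chi hV hφ₁ hψ hj₁ hb₁ hF hFb hi)) ?_
    filter_upwards [(isOpen_chiSource hφ hj).mem_nhds hb,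
      (isOpen_chiSource hφ₁ hj₁).mem_nhds hb₁] with x hx hx₁ hxX
    have h1 := coord_comp_eq (ψ := ψ) (F := F) (l := l) hφ hj hx hxX i
    have h2 := coord_comp_eq (ψ := ψ) (F := F) (l := l) hφ₁ hj₁ hx₁ hxX i
    rw [coord_eq_mul_homCoord (φ₁ := φ₁) hφ hj hx hxX j₁, h1, mul_pow, mul_assoc] at h2
    exact mul_left_cancel₀ (pow_ne_zero l (coord_ne_zero_of_notMem hx hxX)) h2

/-- In the charts `φ` (with the coordinate `j`) and `ψ`, the leading term of `F` at `b` has the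
direction `b'`. -/
def IsLeadValue (F : M → M) (l : ℕ) (φ : OpenPartialHomeomorph M (Fin n → ℂ)) (S : Finset (Fin n))
    (j : Fin n) (ψ : OpenPartialHomeomorph M (Fin n → ℂ)) (T : Finset (Fin n))
    (b b' : BlowUp X) : Prop :=
  ∃ c : ℂ, c ≠ 0 ∧ ∀ i ∈ T, normalVec ψ b' i = c * leadCoord φ S j ψ F l (chi φ S j b) i

theorem IsLeadValue.change_source {b b' : BlowUp X} (h : IsLeadValue F l φ S j ψ T b b')
    (hV : VanishesToOrder X F l) (hφ : IsAdapted r X.carrier φ S)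
    (hφ₁ : IsAdapted r X.carrier φ₁ S₁) (hψ : IsAdapted r X.carrier ψ T) (hj : j ∈ S)
    (hj₁ : j₁ ∈ S₁) (hb : b ∈ chiSource X φ j) (hb₁ : b ∈ chiSource X φ₁ j₁)
    (hF : ContMDiffAt 𝓘(ℂ, Fin n → ℂ) 𝓘(ℂ, Fin n → ℂ) ω F (proj b))
    (hFb : F (proj b) ∈ ψ.source) : IsLeadValue F l φ₁ S₁ j₁ ψ T b b' := by
  obtain ⟨c, hc, h⟩ := h
  obtain ⟨c', hc', h'⟩ := leadCoord_change_source hV hφ hφ₁ hψ hj hj₁ hb hb₁ hF hFb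
  exact ⟨c * c', mul_ne_zero hc hc', fun i hi => by rw [h i hi, h' i hi, mul_assoc]⟩

open Classical in
/-- The coordinates `χ_k` of the lift of `F`, as a function of the coordinates `χ_j`. -/
noncomputable def liftCoord (φ : OpenPartialHomeomorph M (Fin n → ℂ)) (S : Finset (Fin n))
    (j : Fin n) (ψ : OpenPartialHomeomorph M (Fin n → ℂ)) (T : Finset (Fin n)) (k : Fin n)
    (F : M → M) (l : ℕ) (w : Fin n → ℂ) : Fin n → ℂ := fun h =>
  if h ∈ T ∧ h ≠ k then leadCoord φ S j ψ F l w h / leadCoord φ S j ψ F l w k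
  else ψ (F (φ.symm (beta S j w))) h

omit [IsManifold 𝓘(ℂ, Fin n → ℂ) ω M] in
theorem IsLeadValue.chi_eq {b b' : BlowUp X} (h : IsLeadValue F l φ S j ψ T b b') {k : Fin n}
    (hk : k ∈ T) (hφ : IsAdapted r X.carrier φ S) (hj : j ∈ S) (hb : b ∈ chiSource X φ j)
    (hp : proj b' = F (proj b)) :
    chi ψ T k b' = liftCoord φ S j ψ T k F l (chi φ S j b) := by
  obtain ⟨c, hc, h⟩ := h
  funext i
  by_cases hi : i ∈ T ∧ i ≠ k
  · rw [chi_ratio _ hi.1 hi.2, h i hi.1, h k hk, mul_div_mul_left _ _ hc]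
    simp [liftCoord, hi]
  · simp only [chi, liftCoord, hi, if_false, hp, symm_beta_chi hφ hj hb]

omit [IsManifold 𝓘(ℂ, Fin n → ℂ) ω M] in
theorem isLeadValue_of_notMem (hφ : IsAdapted r X.carrier φ S) (hj : j ∈ S)
    {b b' : BlowUp X} (hb : b ∈ chiSource X φ j) (hbX : proj b ∉ X.carrier)
    (hb' : proj b' ∉ X.carrier) (hp : proj b' = F (proj b)) :
    IsLeadValue F l φ S j ψ T b b' :=
  ⟨φ (proj b) j ^ l, pow_ne_zero _ (coord_ne_zero_of_notMem hb hbX), fun i _ => by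
    rw [normalVec_of_notMem hb', hp, coord_comp_eq hφ hj hb hbX]⟩

-- Numerators and denominator are holomorphic after the common factor `w_j ^ l` has been removed, so
-- the lift has a holomorphic expression across `E_X`.
omit [IsManifold 𝓘(ℂ, Fin n → ℂ) ω M] in
theorem analyticAt_liftCoord (hV : VanishesToOrder X F l) (hφ : IsAdapted r X.carrier φ S)
    (hψ : IsAdapted r X.carrier ψ T) (hj : j ∈ S) {w : Fin n → ℂ} (hw : w ∈ chiTarget φ S j)
    (hF : ContMDiffAt 𝓘(ℂ, Fin n → ℂ) 𝓘(ℂ, Fin n → ℂ) ω F (φ.symm (beta S j w)))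
    (hw' : F (φ.symm (beta S j w)) ∈ ψ.source) {k : Fin n} (hk : k ∈ T)
    (hne : leadCoord φ S j ψ F l w k ≠ 0) :
    AnalyticAt ℂ (liftCoord φ S j ψ T k F l) w := by
  refine AnalyticAt.pi fun h => ?_
  by_cases hh : h ∈ T ∧ h ≠ k
  · have heq : (fun x => liftCoord φ S j ψ T k F l x h) =
        fun x => leadCoord φ S j ψ F l x h / leadCoord φ S j ψ F l x k :=
      funext fun x => if_pos hh
    rw [heq]
    exact (analyticAt_leadCoord hV hφ hψ hj hw hF hw' hh.1).div
      (analyticAt_leadCoord hV hφ hψ hj hw hF hw' hk) hne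
  · simp only [liftCoord, hh, if_false]
    exact ((ContinuousLinearMap.proj (R := ℂ) (φ := fun _ : Fin n => ℂ) h).analyticAt _).comp
      ((analyticAt_writtenInCharts hφ.mem_maximalAtlas hψ.mem_maximalAtlas hw hF hw').comp
        (analyticAt_beta S j w))

/-- Off `E_X` the point `F (σ x)` has homogeneous coordinates in `ψ₁` computed by `homCoord` from
its `χ_k` coordinates, and the latter are `liftCoord`. Both sides are continuous at `b` once `w_j ^
l` is cancelled, so the relation holds at `b` too. -/
theorem IsLeadValue.change_target {b b' : BlowUp X} (h : IsLeadValue F l φ S j ψ T b b')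
    (hV : VanishesToOrder X F l) (hφ : IsAdapted r X.carrier φ S)
    (hψ : IsAdapted r X.carrier ψ T) (hψ₁ : IsAdapted r X.carrier ψ₁ T₁) (hj : j ∈ S)
    (hb : b ∈ chiSource X φ j)
    (hF : ContMDiffAt 𝓘(ℂ, Fin n → ℂ) 𝓘(ℂ, Fin n → ℂ) ω F (proj b))
    (hFb : F (proj b) ∈ ψ.source) (hFb₁ : F (proj b) ∈ ψ₁.source) (hp : proj b' = F (proj b)) :
    IsLeadValue F l φ S j ψ₁ T₁ b b' := by
  obtain ⟨k, hk, hb'⟩ := exists_mem_chiSource hψ (b := b') (by rwa [hp])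
  obtain ⟨c, hc, hcv⟩ := id h
  have hRk : leadCoord φ S j ψ F l (chi φ S j b) k ≠ 0 := by
    have := hb'.2
    rw [hcv k hk] at this
    exact right_ne_zero_of_mul this
  have hchi := h.chi_eq hk hφ hj hb hp
  obtain ⟨d, hd, hdv⟩ := normalVec_eq_homCoord hψ hψ₁ hk hb' (by rwa [hp])
  have hw := (bijOn_chi hφ hj).mapsTo hb
  have hF' := hF
  have hFb' := hFb
  rw [← symm_beta_chi hφ hj hb] at hF' hFb'
  have hlift : ContinuousAt (fun x => liftCoord φ S j ψ T k F l (chi φ S j x)) b :=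
    ContinuousAt.comp (f := chi φ S j)
      (analyticAt_liftCoord hV hφ hψ hj hw hF' hFb' hk hRk).continuousAt
      (continuousAt_chi hφ hj hb)
  have hRkc := continuousAt_leadCoord_chi hV hφ hψ hj hb hF hFb hk
  have hFc : ContinuousAt (fun x : BlowUp X => F (proj x)) b :=
    ContinuousAt.comp (f := (proj : BlowUp X → M)) hF.continuousAt (continuousAt_proj hφ hj hb)
  -- `d` relates `b'` to `homCoord`, and `key` below relates `homCoord` to `leadCoord` for `ψ₁` with
  -- the factor `leadCoord` of index `k`.
  refine ⟨d / leadCoord φ S j ψ F l (chi φ S j b) k, div_ne_zero hd hRk, fun i hi => ?_⟩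
  have hhom : ContinuousAt
      (fun x => homCoord ψ ψ₁ T k (liftCoord φ S j ψ T k F l (chi φ S j x)) i) b := by
    refine ContinuousAt.comp (g := fun w => homCoord ψ ψ₁ T k w i)
      (f := fun x => liftCoord φ S j ψ T k F l (chi φ S j x)) ?_ hlift
    rw [← hchi]
    refine (analyticAt_homCoord hψ hψ₁ ((bijOn_chi hψ hk).mapsTo hb') ?_ hi).continuousAt
    rwa [symm_beta_chi hψ hk hb', hp]
  have key : leadCoord φ S j ψ₁ F l (chi φ S j b) i = leadCoord φ S j ψ F l (chi φ S j b) k *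
      homCoord ψ ψ₁ T k (liftCoord φ S j ψ T k F l (chi φ S j b)) i := by
    refine eq_of_eventually_notMem hφ hj hb
      (f := fun x => leadCoord φ S j ψ₁ F l (chi φ S j x) i)
      (g := fun x => leadCoord φ S j ψ F l (chi φ S j x) k *
        homCoord ψ ψ₁ T k (liftCoord φ S j ψ T k F l (chi φ S j x)) i)
      (continuousAt_leadCoord_chi hV hφ hψ₁ hj hb hF hFb₁ hi) (hRkc.mul hhom) ?_
    filter_upwards [(isOpen_chiSource hφ hj).mem_nhds hb, hFc (ψ.open_source.mem_nhds hFb),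
      hRkc.eventually_ne hRk] with x hx hxψ hxk hxX
    have hk0 : ψ (F (proj x)) k ≠ 0 := by
      rw [coord_comp_eq (l := l) hφ hj hx hxX]
      exact mul_ne_zero (pow_ne_zero _ (coord_ne_zero_of_notMem hx hxX)) hxk
    have hFX : F (proj x) ∉ X.carrier := fun h0 => hk0 ((hψ.mem_iff _ hxψ).1 h0 k hk)
    -- A nonzero `k`-th coordinate puts `F (σ x)` off `X`, so it is itself a point of the blow-up to
    -- which the coordinate change applies.
    let y : BlowUp X := pt (F (proj x)) hFX
    have hy : y ∈ chiSource X ψ k := ⟨hxψ, hk0⟩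
    have h1 := coord_eq_mul_homCoord (φ₁ := ψ₁) hψ hk hy hFX i
    have h2 : IsLeadValue F l φ S j ψ T x y := isLeadValue_of_notMem hφ hj hx hxX hFX rfl
    rw [h2.chi_eq hk hφ hj hx rfl] at h1
    change ψ₁ (F (proj x)) i = ψ (F (proj x)) k * _ at h1
    rw [coord_comp_eq (l := l) hφ hj hx hxX, coord_comp_eq (l := l) hφ hj hx hxX, mul_assoc] at h1
    exact mul_left_cancel₀ (pow_ne_zero l (coord_ne_zero_of_notMem hx hxX)) h1
  rw [hdv i hi, hchi, key]
  field_simp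

/-! ### Separation of the points of a fibre of `E_X` -/

/-- Two points of the blow-up over the same point of `X` have disjoint neighbourhoods. -/
theorem eq_of_le_nhds {b b' : BlowUp X} (h : proj b = proj b') (hb : proj b ∈ X.carrier)
    {α : Type*} {𝓕 : Filter α} [𝓕.NeBot] {u : α → BlowUp X} (hu : Filter.Tendsto u 𝓕 (𝓝 b))
    (hu' : Filter.Tendsto u 𝓕 (𝓝 b')) : b = b' := by
  obtain ⟨φ, S, hφ, hbφ⟩ := X.exists_adapted _ hb
  obtain ⟨j, hj, hbj⟩ := exists_mem_chiSource hφ hbφ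
  obtain ⟨k, hk, hbk⟩ := exists_mem_chiSource hφ (b := b') (by rwa [← h])
  have hlim := (continuousAt_chi hφ hj hbj).tendsto.comp hu
  have hlim' := (continuousAt_chi hφ hk hbk).tendsto.comp hu'
  -- Along `u` the `k`-th entry of `χ_j` and the `j`-th entry of `χ_k` are inverse to each other. In
  -- the limit their product is still 1, so the `j`-th homogeneous coordinate of `b'` is nonzero;
  -- one chart then contains both points and is injective.
  have hbj' : b' ∈ chiSource X φ j := by
    by_cases hjk : j = k
    · rwa [hjk]
    have h1 : Filter.Tendsto (fun a => chi φ S j (u a) k * chi φ S k (u a) j) 𝓕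
        (𝓝 (chi φ S j b k * chi φ S k b' j)) :=
      ((tendsto_pi_nhds.1 hlim) k).mul ((tendsto_pi_nhds.1 hlim') j)
    have h2 : Filter.Tendsto (fun a => chi φ S j (u a) k * chi φ S k (u a) j) 𝓕 (𝓝 1) := by
      refine Filter.Tendsto.congr' ?_ tendsto_const_nhds
      filter_upwards [hu ((isOpen_chiSource hφ hj).mem_nhds hbj),
        hu' ((isOpen_chiSource hφ hk).mem_nhds hbk)] with a ha ha'
      have h3 := ha.2
      have h4 := ha'.2
      rw [chi_ratio _ hk (Ne.symm hjk), chi_ratio _ hj hjk]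
      field_simp
    have h3 := tendsto_nhds_unique h1 h2
    have h4 : chi φ S k b' j ≠ 0 := right_ne_zero_of_mul (h3 ▸ one_ne_zero)
    rw [chi_ratio _ hj hjk] at h4
    exact ⟨hbk.1, (div_ne_zero_iff.1 h4).1⟩
  exact injOn_chi hφ hj hbj hbj' (tendsto_nhds_unique hlim
    ((continuousAt_chi hφ hj hbj').tendsto.comp hu'))

/-! ### Construction and holomorphy of the lift -/

/-- `G` is the lift of `F` given, over `X`, by the leading terms of `F`. -/
structure IsLeadingLift (X : ClosedSubmanifold n M r) (F : M → M) (l : ℕ)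
    (G : BlowUp X → BlowUp X) : Prop where
  proj_eq : ∀ b, proj b ∈ X.carrier → proj (G b) = F (proj b)
  isLeadValue : ∀ b, proj b ∈ X.carrier → ∀ φ S j ψ T, IsAdapted r X.carrier φ S →
    IsAdapted r X.carrier ψ T → j ∈ S → b ∈ chiSource X φ j → F (proj b) ∈ ψ.source →
    IsLeadValue F l φ S j ψ T b (G b)
  proj_eq_of_notMem : ∀ b, proj b ∉ X.carrier → F (proj b) ∉ X.carrier → proj (G b) = F (proj b)

/-- The value is the direction of the leading term in the one pair of charts where it is known to be
nonzero; the two changes of charts give the property in all others. -/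
theorem exists_leadValue (hF : IsHolSelfGerm n X.carrier F) (hV : VanishesToOrder X F l)
    {b : BlowUp X} (hb : proj b ∈ X.carrier) (hφ : IsAdapted r X.carrier φ S)
    (hψ : IsAdapted r X.carrier ψ T) (hbφ : proj b ∈ φ.source) (hbψ : F (proj b) ∈ ψ.source)
    (hlead : ∀ v, normalTerm φ S ψ T F (proj b) l v = 0 → v = 0) :
    ∃ b' : BlowUp X, proj b' = F (proj b) ∧ ∀ φ₁ S₁ j₁ ψ₁ T₁, IsAdapted r X.carrier φ₁ S₁ →
      IsAdapted r X.carrier ψ₁ T₁ → j₁ ∈ S₁ → b ∈ chiSource X φ₁ j₁ → F (proj b) ∈ ψ₁.source →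
      IsLeadValue F l φ₁ S₁ j₁ ψ₁ T₁ b b' := by
  cases b with
  | pt q hq => exact absurd hb hq
  | exc p hp e =>
  change p ∈ φ.source at hbφ
  change F p ∈ ψ.source at hbψ
  obtain ⟨j, hj, hbj⟩ := exists_mem_chiSource hφ (b := exc p hp e) hbφ
  set v := (iota hφ hbφ hp e).rep with hv
  have hv0 : v ≠ 0 := Projectivization.rep_nonzero _
  obtain ⟨hvj, hN⟩ := normalTerm_eq_leadCoord (ψ := ψ) (T := T) (F := F) (l := l) hφ hj hbφ hp e
    hbj v hv0 (Projectivization.mk_rep _).symm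
  have hP : normalTerm φ S ψ T F p l v ≠ 0 := fun h => hv0 (hlead v h)
  obtain ⟨c, hc, hcv⟩ := (iota_eq_mk_iff hψ hbψ (hF.mapsTo hp) ((iota hψ hbψ (hF.mapsTo hp)).symm
    (Projectivization.mk ℂ _ hP)) _ hP).1 (Equiv.apply_symm_apply _ _)
  refine ⟨exc (F p) (hF.mapsTo hp) ((iota hψ hbψ (hF.mapsTo hp)).symm
    (Projectivization.mk ℂ _ hP)), rfl, fun φ₁ S₁ j₁ ψ₁ T₁ hφ₁ hψ₁ hj₁ hbj₁ hbψ₁ => ?_⟩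
  have hFp : ContMDiffAt 𝓘(ℂ, Fin n → ℂ) 𝓘(ℂ, Fin n → ℂ) ω F p :=
    (Filter.Eventually.self_of_nhdsSet hF.holomorphic) p hp
  have h1 : IsLeadValue F l φ S j ψ T (exc p hp e) (exc (F p) (hF.mapsTo hp)
      ((iota hψ hbψ (hF.mapsTo hp)).symm (Projectivization.mk ℂ _ hP))) :=
    -- `c` comes from the choice of representative in the target fibre, `v_j ^ l` from normalizing
    -- the `j`-th entry of `v` to 1.
    ⟨c * v ⟨j, hj⟩ ^ l, mul_ne_zero hc (pow_ne_zero _ hvj), fun i hi => by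
      rw [hcv i hi, hN ⟨i, hi⟩, mul_assoc]⟩
  exact (h1.change_target hV hφ hψ hψ₁ hj hbj hFp hbψ hbψ₁ rfl).change_source hV hφ hφ₁ hψ₁ hj hj₁
    hbj hbj₁ hFp hbψ₁

theorem exists_isLeadingLift (hF : IsHolSelfGerm n X.carrier F) (hnd : IsNondegenerate X F) :
    ∃ G : BlowUp X → BlowUp X, IsLeadingLift X F (order X F).toNat G := by
  classical
  have hex : ∀ b : BlowUp X, proj b ∈ X.carrier → ∃ b' : BlowUp X, proj b' = F (proj b) ∧
      ∀ φ S j ψ T, IsAdapted r X.carrier φ S → IsAdapted r X.carrier ψ T → j ∈ S →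
        b ∈ chiSource X φ j → F (proj b) ∈ ψ.source →
        IsLeadValue F (order X F).toNat φ S j ψ T b b' := by
    intro b hb
    obtain ⟨φ, S, ψ, T, hφ, hψ, hbφ, hbψ, hlead⟩ := (hnd _ hb).leading
    exact exists_leadValue hF (vanishesToOrder_order X F) hb hφ hψ hbφ hbψ fun v => (hlead v).1
  choose! g hg hg' using hex
  -- The value `b` at points off `X` mapped into `X` is a filler: `IsLeadingLift.eventually` shows
  -- that there are no such points near `E_X`.
  refine ⟨fun b => if proj b ∈ X.carrier then g b else
    if h : F (proj b) ∈ X.carrier then b else pt (F (proj b)) h, ?_, ?_, ?_⟩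
  · intro b hb
    simpa [hb] using hg b hb
  · intro b hb
    simpa [hb] using hg' b hb
  · intro b hb hb'
    simp only [hb, hb', if_false, dif_neg, not_false_eq_true]
    rfl

omit [IsManifold 𝓘(ℂ, Fin n → ℂ) ω M] in
theorem IsLeadingLift.leadCoord_ne_zero {G : BlowUp X → BlowUp X} (hG : IsLeadingLift X F l G)
    (hφ : IsAdapted r X.carrier φ S) (hψ : IsAdapted r X.carrier ψ T) (hj : j ∈ S) {b : BlowUp X}
    (hb : b ∈ chiSource X φ j) (hbX : proj b ∈ X.carrier) (hbψ : F (proj b) ∈ ψ.source)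
    {k : Fin n} (hk : k ∈ T) (hGb : G b ∈ chiSource X ψ k) :
    leadCoord φ S j ψ F l (chi φ S j b) k ≠ 0 := by
  obtain ⟨c, -, hcv⟩ := hG.isLeadValue b hbX φ S j ψ T hφ hψ hj hb hbψ
  have := hGb.2
  rw [hcv k hk] at this
  exact right_ne_zero_of_mul this

/-- One nonzero `leadCoord` stays nonzero nearby. Off `E_X` it makes a normal coordinate of `F (σ
x)` nonzero, so `F (σ x)` is off `X` and `G` is forced to be `F` there; on `E_X` the properties are
those of a leading lift. -/
theorem IsLeadingLift.eventually {G : BlowUp X → BlowUp X} (hG : IsLeadingLift X F l G)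
    (hV : VanishesToOrder X F l)
    (hφ : IsAdapted r X.carrier φ S) (hψ : IsAdapted r X.carrier ψ T) (hj : j ∈ S) {b : BlowUp X}
    (hb : b ∈ chiSource X φ j) (hbX : proj b ∈ X.carrier) (hbψ : F (proj b) ∈ ψ.source)
    (hF : ContMDiffAt 𝓘(ℂ, Fin n → ℂ) 𝓘(ℂ, Fin n → ℂ) ω F (proj b))
    {k : Fin n} (hk : k ∈ T) (hGb : G b ∈ chiSource X ψ k) :
    ∀ᶠ x in 𝓝 b, x ∈ chiSource X φ j ∧ F (proj x) ∈ ψ.source ∧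
      leadCoord φ S j ψ F l (chi φ S j x) k ≠ 0 ∧
      (F (proj x) ∈ X.carrier → proj x ∈ X.carrier) ∧ proj (G x) = F (proj x) ∧
      IsLeadValue F l φ S j ψ T x (G x) := by
  have hR := hG.leadCoord_ne_zero hφ hψ hj hb hbX hbψ hk hGb
  have hFc : ContinuousAt (fun x : BlowUp X => F (proj x)) b :=
    ContinuousAt.comp (f := (proj : BlowUp X → M)) hF.continuousAt (continuousAt_proj hφ hj hb)
  filter_upwards [(isOpen_chiSource hφ hj).mem_nhds hb, hFc (ψ.open_source.mem_nhds hbψ),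
    (continuousAt_leadCoord_chi hV hφ hψ hj hb hF hbψ hk).eventually_ne hR] with x hx hxψ hxk
  by_cases hxX : proj x ∈ X.carrier
  · exact ⟨hx, hxψ, hxk, fun _ => hxX, hG.proj_eq x hxX,
      hG.isLeadValue x hxX φ S j ψ T hφ hψ hj hx hxψ⟩
  · have hk0 : ψ (F (proj x)) k ≠ 0 := by
      rw [coord_comp_eq (l := l) hφ hj hx hxX]
      exact mul_ne_zero (pow_ne_zero _ (coord_ne_zero_of_notMem hx hxX)) hxk
    have hFX : F (proj x) ∉ X.carrier := fun h0 => hk0 ((hψ.mem_iff _ hxψ).1 h0 k hk)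
    have hp := hG.proj_eq_of_notMem x hxX hFX
    exact ⟨hx, hxψ, hxk, fun h => absurd h hFX, hp,
      isLeadValue_of_notMem hφ hj hx hxX (by rwa [hp]) hp⟩

/-- In the charts `χ_j` and `χ_k` the map `G` is `liftCoord`, which is analytic. -/
theorem contMDiffAt_of_isLeadValue {G : BlowUp X → BlowUp X} (hV : VanishesToOrder X F l)
    (hφ : IsAdapted r X.carrier φ S) (hψ : IsAdapted r X.carrier ψ T) (hj : j ∈ S) {k : Fin n}
    (hk : k ∈ T) {b : BlowUp X}
    (hF : ContMDiffAt 𝓘(ℂ, Fin n → ℂ) 𝓘(ℂ, Fin n → ℂ) ω F (proj b))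
    (hb : ∀ᶠ x in 𝓝 b, x ∈ chiSource X φ j ∧ F (proj x) ∈ ψ.source ∧
      leadCoord φ S j ψ F l (chi φ S j x) k ≠ 0 ∧
      (F (proj x) ∈ X.carrier → proj x ∈ X.carrier) ∧ proj (G x) = F (proj x) ∧
      IsLeadValue F l φ S j ψ T x (G x)) :
    ContMDiffAt 𝓘(ℂ, Fin n → ℂ) 𝓘(ℂ, Fin n → ℂ) ω G b := by
  obtain ⟨e, he, hes, -, hef⟩ := exists_chiChart hφ hj b
  obtain ⟨e', he', hes', -, hef'⟩ := exists_chiChart hψ hk b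
  have key : ∀ᶠ x in 𝓝 b, G x ∈ e'.source ∧
      e' (G x) = liftCoord φ S j ψ T k F l (e x) := by
    filter_upwards [hb] with x ⟨h1, h2, h3, _, h5, h6⟩
    rw [hes', hef, hef']
    refine ⟨⟨by rwa [h5], ?_⟩, h6.chi_eq hk hφ hj h1 h5⟩
    obtain ⟨c, hc, hcv⟩ := h6
    rw [hcv k hk]
    exact mul_ne_zero hc h3
  obtain ⟨hb1, hb2, hb3, -⟩ := hb.self_of_nhds
  have hk' := key.self_of_nhds
  have hA : AnalyticAt ℂ (liftCoord φ S j ψ T k F l) (e b) := by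
    rw [hef]
    rw [← symm_beta_chi hφ hj hb1] at hF hb2
    exact analyticAt_liftCoord hV hφ hψ hj ((bijOn_chi hφ hj).mapsTo hb1) hF hb2 hk hb3
  have h1 := contMDiffAt_of_mem_maximalAtlas he (x := b) (by rwa [hes])
  have h2 : ContMDiffAt 𝓘(ℂ, Fin n → ℂ) 𝓘(ℂ, Fin n → ℂ) ω (liftCoord φ S j ψ T k F l) (e b) :=
    hA.contDiffAt.contMDiffAt
  have h3 := contMDiffAt_symm_of_mem_maximalAtlas he' (e'.map_source hk'.1)
  rw [hk'.2] at h3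
  refine (h3.comp b (h2.comp b h1)).congr_of_eventuallyEq ?_
  filter_upwards [key] with x hx
  simp only [Function.comp]
  rw [← hx.2, e'.left_inv hx.1]

omit [IsManifold 𝓘(ℂ, Fin n → ℂ) ω M] in
theorem IsLeadingLift.exists_charts (hF : IsHolSelfGerm n X.carrier F) {G : BlowUp X → BlowUp X}
    (hG : IsLeadingLift X F l G) {b : BlowUp X} (hbX : proj b ∈ X.carrier) :
    ∃ φ S j ψ T k, IsAdapted r X.carrier φ S ∧ IsAdapted r X.carrier ψ T ∧ j ∈ S ∧ k ∈ T ∧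
      b ∈ chiSource X φ j ∧ F (proj b) ∈ ψ.source ∧ G b ∈ chiSource X ψ k := by
  obtain ⟨φ, S, hφ, hbφ⟩ := X.exists_adapted _ hbX
  obtain ⟨j, hj, hbj⟩ := exists_mem_chiSource hφ hbφ
  obtain ⟨ψ, T, hψ, hbψ⟩ := X.exists_adapted _ (hF.mapsTo hbX)
  obtain ⟨k, hk, hbk⟩ := exists_mem_chiSource hψ (b := G b) (by rwa [hG.proj_eq b hbX])
  exact ⟨φ, S, j, ψ, T, k, hφ, hψ, hj, hk, hbj, hbψ, hbk⟩

theorem IsLeadingLift.isLift (hF : IsHolSelfGerm n X.carrier F) (hV : VanishesToOrder X F l)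
    {G : BlowUp X → BlowUp X} (hG : IsLeadingLift X F l G) : IsLift X F G := by
  refine ⟨⟨?_, fun b hb => ?_⟩, ?_⟩
  · refine eventually_nhdsSet_iff_forall.2 fun b hbX => ?_
    obtain ⟨φ, S, j, ψ, T, k, hφ, hψ, hj, hk, hbj, hbψ, hbk⟩ := hG.exists_charts hF hbX
    have hFb := (eventually_nhdsSet_iff_forall.1 hF.holomorphic) _ hbX
    have hFx := (continuousAt_proj hφ hj hbj).eventually hFb
    filter_upwards [hFx, (hG.eventually hV hφ hψ hj hbj hbX hbψ hFb.self_of_nhds hk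
      hbk).eventually_nhds] with x hx hx'
    exact contMDiffAt_of_isLeadValue hV hφ hψ hj hk hx hx'
  · change proj (G b) ∈ X.carrier
    rw [hG.proj_eq b hb]
    exact hF.mapsTo hb
  · refine eventually_nhdsSet_iff_forall.2 fun b hbX => ?_
    obtain ⟨φ, S, j, ψ, T, k, hφ, hψ, hj, hk, hbj, hbψ, hbk⟩ := hG.exists_charts hF hbX
    have hFb := (eventually_nhdsSet_iff_forall.1 hF.holomorphic) _ hbX
    filter_upwards [hG.eventually hV hφ hψ hj hbj hbX hbψ hFb.self_of_nhds hk hbk] with x hx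
    exact hx.2.2.2.2.1.symm

/-! ### Uniqueness of the lift and its values on `E_X` -/

/-- Off `E_X`, close to it, both lifts lie over the same point off `X`, hence coincide. On `E_X`
both values lie over `F (σ b)` and are limits of the same map from the complement. -/
theorem IsLeadingLift.eventuallyEq (hF : IsHolSelfGerm n X.carrier F) (hV : VanishesToOrder X F l)
    {G G' : BlowUp X → BlowUp X} (hG : IsLeadingLift X F l G) (hG' : IsLift X F G') :
    G' =ᶠ[𝓝ˢ (excDivisor X)] G := by
  have hoff : ∀ b ∈ excDivisor X, ∀ᶠ x in 𝓝 b, proj x ∉ X.carrier → G' x = G x := by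
    intro b hbX
    obtain ⟨φ, S, j, ψ, T, k, hφ, hψ, hj, hk, hbj, hbψ, hbk⟩ := hG.exists_charts hF hbX
    have hFb := (eventually_nhdsSet_iff_forall.1 hF.holomorphic) _ hbX
    filter_upwards [hG.eventually hV hφ hψ hj hbj hbX hbψ hFb.self_of_nhds hk hbk,
      (eventually_nhdsSet_iff_forall.1 hG'.comm) b hbX] with x ⟨_, _, _, hx, hxG, _⟩ hx' hxX
    have hFx : F (proj x) ∉ X.carrier := fun h => hxX (hx h)
    exact eq_of_proj_eq (by rwa [← hx']) (by rw [← hx', hxG])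
  have hon : ∀ b ∈ excDivisor X, G' b = G b := by
    intro b hbX
    obtain ⟨φ, S, j, -, -, -, hφ, -, hj, -, hbj, -, -⟩ := hG.exists_charts hF hbX
    have hc := ((hG.isLift hF hV).isHolSelfGerm.holomorphic.self_of_nhdsSet b hbX).continuousAt
    have hc' := (hG'.isHolSelfGerm.holomorphic.self_of_nhdsSet b hbX).continuousAt
    have hp : proj (G' b) = proj (G b) := by
      rw [← hG'.comm.self_of_nhdsSet b hbX, hG.proj_eq b hbX]
    let 𝓕 := 𝓝[{x | proj x ∉ X.carrier}] b
    have : 𝓕.NeBot := mem_closure_iff_nhdsWithin_neBot.1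
      (mem_closure_iff_frequently.2 (frequently_notMem hφ hj hbj))
    -- Separation inside one fibre is enough: the two limits are already known to have the same
    -- projection.
    refine eq_of_le_nhds hp (hG'.isHolSelfGerm.mapsTo hbX) (𝓕 := 𝓕) (u := G)
      (Filter.Tendsto.congr' ?_ (hc'.tendsto.mono_left nhdsWithin_le_nhds))
      (hc.tendsto.mono_left nhdsWithin_le_nhds)
    filter_upwards [nhdsWithin_le_nhds (hoff b hbX), self_mem_nhdsWithin] with x hx hxX
    exact hx hxX
  refine eventually_nhdsSet_iff_forall.2 fun b hbX => ?_
  filter_upwards [hoff b hbX] with x hx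
  by_cases hxX : proj x ∈ X.carrier
  · exact hon x hxX
  · exact hx hxX

-- The leading-value property is available in every pair of adapted charts, so the formula needs no
-- further change of charts; nonvanishing of the leading term comes from a chart `χ_k` around the
-- value `G [v]`.
omit [IsManifold 𝓘(ℂ, Fin n → ℂ) ω M] in
theorem IsLeadingLift.apply_exc (hF : IsHolSelfGerm n X.carrier F) {G : BlowUp X → BlowUp X}
    (hG : IsLeadingLift X F l G) (hφ : IsAdapted r X.carrier φ S) (hψ : IsAdapted r X.carrier ψ T)
    {p : M} (hp : p ∈ X.carrier) (hpφ : p ∈ φ.source) (hpψ : F p ∈ ψ.source)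
    (e : ExcFiber n X.carrier p) (v : S → ℂ) (hv : v ≠ 0)
    (he : iota hφ hpφ hp e = Projectivization.mk ℂ v hv) :
    ∃ hP : normalTerm φ S ψ T F p l v ≠ 0,
      G (exc p hp e) = exc (F p) (hF.mapsTo hp)
        ((iota hψ hpψ (hF.mapsTo hp)).symm
          (Projectivization.mk ℂ (normalTerm φ S ψ T F p l v) hP)) := by
  obtain ⟨j, hj, hbj⟩ := exists_mem_chiSource hφ (b := exc p hp e) hpφ
  obtain ⟨hvj, hN⟩ := normalTerm_eq_leadCoord (ψ := ψ) (T := T) (F := F) (l := l) hφ hj hpφ hp e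
    hbj v hv he
  have hGp := hG.proj_eq (exc p hp e) hp
  obtain ⟨k, hk, hGk⟩ := exists_mem_chiSource hψ (b := G (exc p hp e)) (by rw [hGp]; exact hpψ)
  have hR := hG.leadCoord_ne_zero hφ hψ hj hbj hp hpψ hk hGk
  have hP : normalTerm φ S ψ T F p l v ≠ 0 := fun h => by
    have := congrFun h ⟨k, hk⟩
    rw [hN] at this
    exact mul_ne_zero (pow_ne_zero _ hvj) hR this
  refine ⟨hP, ?_⟩
  obtain ⟨c, hc, hcv⟩ := hG.isLeadValue (exc p hp e) hp φ S j ψ T hφ hψ hj hbj hpψ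
  generalize G (exc p hp e) = b' at *
  cases b' with
  | pt q hq => exact absurd (hF.mapsTo hp) (by rw [← show q = F p from hGp]; exact hq)
  | exc p' hp' e' =>
    obtain rfl : p' = F p := hGp
    congr 1
    rw [Equiv.eq_symm_apply, iota_eq_mk_iff]
    -- The power undoes the normalization of `v` in `normalTerm_eq_leadCoord`.
    refine ⟨c / v ⟨j, hj⟩ ^ l, div_ne_zero hc (pow_ne_zero _ hvj), fun i hi => ?_⟩
    rw [hcv i hi, hN ⟨i, hi⟩]
    field_simp

end BlowUp

end

end HolBlowUp

/-- Lifting a non-degenerate germ along a closed submanifold to the blow-up. -/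
theorem proposition2p1 {n r : ℕ} {M : Type*} [TopologicalSpace M] [T2Space M]
    [ChartedSpace (Fin n → ℂ) M] [IsManifold 𝓘(ℂ, Fin n → ℂ) ω M]
    (X : ClosedSubmanifold n M r) (F : M → M) (hF : IsHolSelfGerm n X.carrier F)
    (hnd : IsNondegenerate X F) :
    ∃ G : BlowUp X → BlowUp X, IsLift X F G ∧
      (∀ G' : BlowUp X → BlowUp X, IsLift X F G' → G' =ᶠ[𝓝ˢ (BlowUp.excDivisor X)] G) ∧
      ∀ (φ : OpenPartialHomeomorph M (Fin n → ℂ)) (S : Finset (Fin n))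
        (ψ : OpenPartialHomeomorph M (Fin n → ℂ)) (T : Finset (Fin n))
        (hφ : IsAdapted r X.carrier φ S) (hψ : IsAdapted r X.carrier ψ T)
        (p : M) (hp : p ∈ X.carrier) (hpφ : p ∈ φ.source) (hpψ : F p ∈ ψ.source)
        (e : ExcFiber n X.carrier p) (v : S → ℂ) (hv : v ≠ 0),
        iota hφ hpφ hp e = Projectivization.mk ℂ v hv →
        ∃ hP : normalTerm φ S ψ T F p (order X F).toNat v ≠ 0,
          G (BlowUp.exc p hp e) = BlowUp.exc (F p) (hF.mapsTo hp)
            ((iota hψ hpψ (hF.mapsTo hp)).symm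
              (Projectivization.mk ℂ (normalTerm φ S ψ T F p (order X F).toNat v) hP)) := by
  obtain ⟨G, hG⟩ := BlowUp.exists_isLeadingLift hF hnd
  have hV := vanishesToOrder_order X F
  exact ⟨G, hG.isLift hF hV, fun G' hG' => hG.eventuallyEq hF hV hG',
    fun φ S ψ T hφ hψ p hp hpφ hpψ e v hv he => hG.apply_exc hF hφ hψ hp hpφ hpψ e v hv he⟩
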